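/- Let $n\ge 0$ be an integer, $t\in(0,1)$, $\gamma\in\mathbb{C}\setminus\{0\}$, let $(s_x)_{x\ge 0}$ be a sequence of complex numbers, and let $u_1,\dots,u_{2n}$ be pairwise distinct complex numbers such that $1-s_xu_i\neq 0$ for all $i$ and $x$, $1-tu_iu_j\ne 0$ for all $i\neq j$, and, for some $\varepsilon>0$, $$\left|\frac{u_i-s_x}{1-s_xu_i}\right|\le 1-\varepsilon\qquad\text{for all } i=1,\dots,2n \text{ and all } x=0,1,2,\dots.$$ For a signature $\lambda=(\lambda_1\ge\dots\ge\lambda_{N}\ge 0)$ with integer parts, let $m_i(\lambda)$ be the number of parts equal to $i$, let $$F_\lambda(u_1,\dots,u_N)=\sum_{\sigma\in S_N}\sigma\left(\prod_{1\le i<j\le N}\frac{u_i-tu_j}{u_i-u_j}\prod_{i=1}^N\left(\frac{1-t}{1-s_{\lambda_i}u_i}\prod_{j=0}^{\lambda_i-1}\frac{u_i-s_j}{1-s_ju_i}\right)\right),$$ where $\sigma$ acts by permuting the variables $u_i$ (the spin Hall–Littlewood function), and let $(a;t)_k=(1-a)(1-at)\cdots(1-at^{k-1})$. Then the following series, over all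 signatures $\lambda$ with $2n$ parts all of whose multiplicities $m_i(\lambda)$, $i\ge 0$, are even, converges absolutely, and $$\sum_{\lambda:\,m_i(\lambda)\in 2\mathbb{Z}_{\ge0}}\frac{1}{(t;t)_{m_0(\lambda)}}\prod_{j=1}^{m_0(\lambda)/2}(1-s_0^2\gamma^{-1}t^{2j-2})(1-\gamma t^{2j-1})\prod_{j=1}^{2n}(1-s_0u_j)\prod_{i=1}^{\infty}\prod_{j=1}^{m_i(\lambda)/2}\frac{1-s_i^2t^{2j-2}}{1-t^{2j}}\;F_\lambda(u_1,\dots,u_{2n})$$ $$=\prod_{1\le i<j\le 2n}\frac{1-tu_iu_j}{u_i-u_j}\;\mathop{\rm Pf}_{1\le i<j\le 2n}\left[\frac{(u_i-u_j)\bigl((1-t)(1-s_0u_i)(1-s_0u_j)+(1-\gamma)(t-s_0^2\gamma^{-1})(1-u_iu_j)\bigr)}{(1-u_iu_j)(1-tu_iu_j)}\right].$$ -/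

import Mathlib

open scoped Nat

/-- Signatures with `N` parts: weakly decreasing sequences of nonnegative integers. -/
abbrev Signature (N : ℕ) : Type := {lam : Fin N → ℕ // Antitone lam}

/-- The multiplicity `m_i(lam)`: the number of parts of `lam` equal to `i`. -/
def Signature.mult {N : ℕ} (lam : Signature N) (i : ℕ) : ℕ :=
  (Finset.univ.filter fun k : Fin N => lam.1 k = i).card

/-- Signatures all of whose multiplicities (including that of `0`) are even. -/
abbrev EvenSignature (N : ℕ) : Type := {lam : Signature N // ∀ i : ℕ, Even (lam.mult i)}

/-- The `t`-Pochhammer symbol `(a;t)_k = (1-a)(1-at)⋯(1-at^{k-1})`. -/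
def tPochhammer (a t : ℂ) (k : ℕ) : ℂ :=
  ∏ j ∈ Finset.range k, (1 - a * t ^ j)

/-- The function of `u_1, …, u_N` that is symmetrized in the definition of `spinHallLittlewood`. -/
noncomputable def spinHallLittlewoodSummand (t : ℂ) (s : ℕ → ℂ) {N : ℕ} (lam : Signature N)
    (u : Fin N → ℂ) : ℂ :=
  (∏ i : Fin N, ∏ j ∈ Finset.Ioi i, (u i - t * u j) / (u i - u j)) *
    ∏ i : Fin N, ((1 - t) / (1 - s (lam.1 i) * u i) *
      ∏ j ∈ Finset.range (lam.1 i), (u i - s j) / (1 - s j * u i))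

/-- The fully inhomogeneous spin Hall–Littlewood symmetric rational function
`F_lam(u_1, …, u_N)` with quantum parameter `t` and inhomogeneities `s_0, s_1, …`. -/
noncomputable def spinHallLittlewood (t : ℂ) (s : ℕ → ℂ) {N : ℕ} (lam : Signature N)
    (u : Fin N → ℂ) : ℂ :=
  ∑ σ : Equiv.Perm (Fin N), spinHallLittlewoodSummand t s lam (fun i => u (σ i))

/-- The Pfaffian of a (skew-symmetric) `2n × 2n` matrix:
`(2^n n!)⁻¹ ∑_σ sgn(σ) ∏_{i=1}^n A_{σ(2i-1), σ(2i)}`. -/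
noncomputable def pfaffian {n : ℕ} (A : Matrix (Fin (2 * n)) (Fin (2 * n)) ℂ) : ℂ :=
  ((2 : ℂ) ^ n * (n ! : ℂ))⁻¹ *
    ∑ σ : Equiv.Perm (Fin (2 * n)), ((Equiv.Perm.sign σ : ℤ) : ℂ) *
      ∏ i : Fin n, A (σ ⟨2 * (i : ℕ), by omega⟩) (σ ⟨2 * (i : ℕ) + 1, by omega⟩)

/-! The series is organised by levels. Removing the parts equal to 0 (`shl_map_succ_append`,
`hasSum_branching`) turns it into a finite sum over the set J of variables that lie above level 0: a
coefficient depending on the number of zeros, times `splitWeight`, times the Littlewood series in J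
with the parameters shifted by one. The refinement by γ changes only the coefficient, so two facts
suffice: (i) the unrefined identity `littlewoodSum_eq`, whose right side is the matching sum
`littlewoodPf`; (ii) the finite identity `levelSum_eq_refinedPf`, which evaluates the sum over J for
an arbitrary parameter w.

For (ii), both sides are rational in each variable, bounded at infinity, with at most simple poles.
There is no residue where two variables coincide, and at the reciprocal of a variable both residues
are the same multiple of the identity with two variables fewer. By induction the difference is
constant in each variable, hence can be computed at one configuration: a, 1/(ta) and the progression
s, st, ..., where almost every term vanishes (`levelSum_eq_refinedPf_special`).

For (i), take γ = 1 in (ii). The matching sum then factors as `littlewoodPf` times the product of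
the 1 - s_0 a, and branching shows that the error in (i) is the product of (a - s_0)/(1 - s_0 a)
times the error for the shifted parameters. This product has norm at most r < 1, and the errors are
bounded uniformly in the parameters (`exists_norm_tsum_evenTerm_le`), so iteration forces the error
to vanish.

Pfaffians are handled as sums over perfect matchings of a finite set of variables: the antisymmetric
prefactor absorbs the signs (`prod_mul_pfaffian`). -/

/-! ### Sums over perfect matchings. -/

/-- Auxiliary recursion for `matchSum`; the numeral is the number of variables left. -/
noncomputable def matchSumAux (K N : ℂ → ℂ → ℂ) : ℕ → Finset ℂ → ℂ
  | 0, _ => 1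
  | 1, _ => 0
  -- A perfect matching of m + 2 points contains m + 2 ordered pairs, so the average over all
  -- ordered pairs counts it once, without ordering the variables.
  | m + 2, U => ((m + 2 : ℕ) : ℂ)⁻¹ * ∑ a ∈ U, ∑ b ∈ U.erase a,
      N a b * (∏ j ∈ (U.erase a).erase b, K a j * K b j) * matchSumAux K N m ((U.erase a).erase b)

/-- The sum over perfect matchings of `U` of the product of the `N a b` over matched pairs and of
the `K a b` over unmatched pairs: a Pfaffian multiplied by an antisymmetric product. -/
noncomputable def matchSum (K N : ℂ → ℂ → ℂ) (U : Finset ℂ) : ℂ := matchSumAux K N U.card U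

/-- The contribution to `matchSum K N U` of the matchings that contain the pair `a, b`. -/
noncomputable def matchTerm (K N : ℂ → ℂ → ℂ) (U : Finset ℂ) (a b : ℂ) : ℂ :=
  N a b * (∏ j ∈ (U.erase a).erase b, K a j * K b j) * matchSum K N ((U.erase a).erase b)

@[simp] theorem matchSum_empty (K N : ℂ → ℂ → ℂ) : matchSum K N ∅ = 1 := by
  simp [matchSum, matchSumAux]

theorem card_erase_erase {U : Finset ℂ} {a b : ℂ} (ha : a ∈ U) (hb : b ∈ U.erase a) :
    ((U.erase a).erase b).card + 2 = U.card := by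
  have h1 := Finset.card_erase_add_one ha
  have h2 := Finset.card_erase_add_one hb
  omega

theorem matchSum_average (K N : ℂ → ℂ → ℂ) (U : Finset ℂ) (hU : U.Nonempty) :
    (U.card : ℂ) * matchSum K N U = ∑ a ∈ U, ∑ b ∈ U.erase a, matchTerm K N U a b := by
  obtain ⟨m, hm⟩ | h1 : (∃ m, U.card = m + 2) ∨ U.card = 1 := by
    have := hU.card_pos
    by_cases h : U.card = 1
    · right; exact h
    · left; exact ⟨U.card - 2, by omega⟩
  · have hc : ((m + 2 : ℕ) : ℂ) ≠ 0 := Nat.cast_ne_zero.2 (by omega)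
    rw [matchSum, hm, matchSumAux, mul_inv_cancel_left₀ hc]
    refine Finset.sum_congr rfl fun a ha => Finset.sum_congr rfl fun b hb => ?_
    have := card_erase_erase ha hb
    rw [matchTerm, matchSum, show ((U.erase a).erase b).card = m by omega]
  · rw [matchSum, h1, matchSumAux]
    obtain ⟨x, rfl⟩ := Finset.card_eq_one.1 h1
    simp

/-- Expansion of `matchSum` along an arbitrary variable. -/
theorem matchSum_expand {K N : ℂ → ℂ → ℂ} (hK : ∀ a b, K a b = -K b a)
    (hN : ∀ a b, N a b = N b a) {U : Finset ℂ} {a : ℂ} (ha : a ∈ U) :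
    matchSum K N U = ∑ b ∈ U.erase a, matchTerm K N U a b := by
  induction hc : U.card using Nat.strong_induction_on generalizing U a with
  | _ n ih =>
  have key : ∀ a ∈ U, ∀ a' ∈ U,
      ∑ b ∈ U.erase a, matchTerm K N U a b = ∑ b ∈ U.erase a', matchTerm K N U a' b := by
    intro a ha a' ha'
    rcases eq_or_ne a a' with rfl | hne
    · rfl
    -- Either a is matched with a', or it has another partner b and the remaining sum is expanded
    -- along a'. The resulting double sum is symmetric in a and a'.
    have split : ∀ a ∈ U, ∀ a' ∈ U, a ≠ a' → ∑ b ∈ U.erase a, matchTerm K N U a b =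
        matchTerm K N U a a' + ∑ b ∈ (U.erase a).erase a', ∑ b' ∈ ((U.erase a).erase a').erase b,
          N a b * (∏ j ∈ (U.erase a).erase b, K a j * K b j) *
            matchTerm K N ((U.erase a).erase b) a' b' := by
      intro a ha a' ha' hne
      rw [← Finset.add_sum_erase (U.erase a) _ (Finset.mem_erase.2 ⟨hne.symm, ha'⟩)]
      congr 1
      refine Finset.sum_congr rfl fun b hb => ?_
      have hb1 := Finset.mem_of_mem_erase hb
      have hbne := Finset.ne_of_mem_erase hb
      have hcard := card_erase_erase ha hb1
      rw [matchTerm, ih _ (by omega) (U := (U.erase a).erase b) (a := a')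
        (by simp [hne.symm, hbne.symm, ha']) rfl, Finset.mul_sum, Finset.erase_right_comm (a := b)]
    rw [split a ha a' ha' hne, split a' ha' a ha hne.symm, Finset.erase_right_comm (a := a')]
    congr 1
    · rw [matchTerm, matchTerm, Finset.erase_right_comm (a := a'), hN a a']
      simp_rw [mul_comm (K a _)]
    · rw [Finset.sum_comm' (t' := (U.erase a).erase a')
        (s' := fun b => ((U.erase a).erase a').erase b)]
      · refine Finset.sum_congr rfl fun b hb => Finset.sum_congr rfl fun b' hb' => ?_
        have e1 : ((((U.erase a).erase b').erase a').erase b) =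
            (((U.erase a).erase a').erase b).erase b' := by ext; simp; tauto
        have e2 : ((((U.erase a').erase b).erase a).erase b') =
            (((U.erase a).erase a').erase b).erase b' := by ext; simp; tauto
        have m1 : a' ∈ (U.erase a).erase b' := by
          simp only [Finset.mem_erase] at *; tauto
        have m2 : b ∈ ((U.erase a).erase b').erase a' := by
          simp only [Finset.mem_erase] at *; tauto
        have m3 : a ∈ (U.erase a').erase b := by
          simp only [Finset.mem_erase] at *; tauto
        have m4 : b' ∈ ((U.erase a').erase b).erase a := by
          simp only [Finset.mem_erase] at *; tauto
        -- Four kernel factors link the pairs {a, b'} and {a', b}; reversing all four leaves their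
        -- product unchanged.
        rw [matchTerm, matchTerm, e1, e2, ← Finset.mul_prod_erase _ _ m1,
          ← Finset.mul_prod_erase _ _ m2, ← Finset.mul_prod_erase _ _ m3,
          ← Finset.mul_prod_erase _ _ m4, e1, e2, hK a' a, hK a' b', hK b a, hK b b',
          Finset.prod_mul_distrib, Finset.prod_mul_distrib]
        ring
      · intro x y
        simp only [Finset.mem_erase]; tauto
  have hpos : 0 < U.card := Finset.card_pos.2 ⟨a, ha⟩
  have hne : (U.card : ℂ) ≠ 0 := by exact_mod_cast hpos.ne'
  apply mul_left_cancel₀ hne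
  rw [matchSum_average K N U ⟨a, ha⟩, Finset.sum_congr rfl fun x hx => key x hx a ha,
    Finset.sum_const, nsmul_eq_mul]

theorem matchSum_odd (K N : ℂ → ℂ → ℂ) {U : Finset ℂ} (hU : Odd U.card) :
    matchSum K N U = 0 := by
  have : ∀ m, Odd m → ∀ U, matchSumAux K N m U = 0 := by
    intro m
    induction m using Nat.strong_induction_on with
    | _ m ih =>
    intro hm U
    match m, hm, ih with
    | 0, hm, _ => simp at hm
    | 1, _, _ => rfl
    | m + 2, hm, ih =>
      rw [matchSumAux]
      have hm' : Odd m := by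
        rw [Nat.odd_iff] at *; omega
      simp [ih m (by omega) hm']
  exact this _ hU U

theorem matchSum_expand_insert {K N : ℂ → ℂ → ℂ} (hK : ∀ a b, K a b = -K b a)
    (hN : ∀ a b, N a b = N b a) {V : Finset ℂ} {a : ℂ} (ha : a ∉ V) :
    matchSum K N (insert a V) =
      ∑ b ∈ V, N a b * (∏ j ∈ V.erase b, K a j * K b j) * matchSum K N (V.erase b) := by
  rw [matchSum_expand hK hN (Finset.mem_insert_self a V), Finset.erase_insert ha]
  simp only [matchTerm, Finset.erase_insert ha]

/-- Every variable lies in exactly one pair of a matching, so each matching acquires each f x once.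
-/
theorem matchSum_scale {K N N' : ℂ → ℂ → ℂ} (f : ℂ → ℂ) {U : Finset ℂ}
    (h : ∀ a ∈ U, ∀ b ∈ U, N' a b = f a * f b * N a b) :
    matchSum K N' U = (∏ x ∈ U, f x) * matchSum K N U := by
  induction hc : U.card using Nat.strong_induction_on generalizing U with
  | _ n ih =>
  rcases U.eq_empty_or_nonempty with rfl | hne
  · simp
  have hn0 : (U.card : ℂ) ≠ 0 := by exact_mod_cast (Finset.card_pos.2 hne).ne'
  apply mul_left_cancel₀ hn0
  rw [mul_left_comm, matchSum_average _ _ _ hne, matchSum_average _ _ _ hne, Finset.mul_sum]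
  refine Finset.sum_congr rfl fun a ha => ?_
  rw [Finset.mul_sum]
  refine Finset.sum_congr rfl fun b hb => ?_
  have hcard := card_erase_erase ha hb
  have hsub : (U.erase a).erase b ⊆ U := (Finset.erase_subset _ _).trans (Finset.erase_subset _ _)
  rw [matchTerm, matchTerm, ih _ (by omega) (fun x hx y hy => h x (hsub hx) y (hsub hy)) rfl,
    h a ha b (Finset.mem_of_mem_erase hb),
    ← Finset.mul_prod_erase U f ha, ← Finset.mul_prod_erase (U.erase a) f hb]
  ring

/-! ### Rational functions of one variable with simple poles, and a Liouville argument. -/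

open Filter Topology in
theorem eventually_notMem_finset {S : Finset ℂ} {s : ℂ} (h : s ∉ S) : ∀ᶠ a in 𝓝 s, a ∉ S :=
  IsOpen.mem_nhds (S.finite_toSet.isClosed.isOpen_compl) (by simpa using h)

open Filter Topology Polynomial in
/-- `f` agrees outside the finite set `S` with a rational function that is bounded at infinity and
has at most simple poles, all of them in `S`. -/
def ProperRat (S : Finset ℂ) (f : ℂ → ℂ) : Prop :=
  ∃ p : ℂ[X], p.natDegree ≤ S.card ∧ ∀ a ∉ S, f a * ∏ s ∈ S, (a - s) = p.eval a

namespace ProperRat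
open Filter Topology Polynomial

variable {S T : Finset ℂ} {f g : ℂ → ℂ}

theorem congr (hf : ProperRat S f) (h : ∀ a ∉ S, g a = f a) : ProperRat S g := by
  obtain ⟨p, hp, hpe⟩ := hf
  exact ⟨p, hp, fun a ha => by rw [h a ha, hpe a ha]⟩

theorem const (c : ℂ) : ProperRat ∅ fun _ => c :=
  ⟨C c, by simp, fun a _ => by simp⟩

/-- Disjointness keeps the poles simple. -/
theorem mul (hf : ProperRat S f) (hg : ProperRat T g) (hST : Disjoint S T) :
    ProperRat (S ∪ T) fun a => f a * g a := by
  obtain ⟨p, hp, hpe⟩ := hf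
  obtain ⟨q, hq, hqe⟩ := hg
  refine ⟨p * q, ?_, fun a ha => ?_⟩
  · rw [Finset.card_union_of_disjoint hST]
    exact natDegree_mul_le.trans (add_le_add hp hq)
  · rw [Finset.mem_union, not_or] at ha
    rw [Finset.prod_union hST, eval_mul, ← hpe a ha.1, ← hqe a ha.2]
    ring

theorem one_of (S : Finset ℂ) : ProperRat S fun _ => 1 := by
  refine ⟨∏ s ∈ S, (X - C s), ?_, fun a _ => by simp [eval_prod]⟩
  rw [natDegree_prod_of_monic _ _ fun s _ => monic_X_sub_C s]
  simp

theorem mono (hf : ProperRat S f) (h : S ⊆ T) : ProperRat T f := by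
  have := hf.mul (one_of (T \ S)) Finset.disjoint_sdiff
  rw [Finset.union_sdiff_of_subset h] at this
  simpa using this

theorem add (hf : ProperRat S f) (hg : ProperRat S g) : ProperRat S fun a => f a + g a := by
  obtain ⟨p, hp, hpe⟩ := hf
  obtain ⟨q, hq, hqe⟩ := hg
  refine ⟨p + q, (natDegree_add_le _ _).trans (max_le hp hq), fun a ha => ?_⟩
  rw [add_mul, hpe a ha, hqe a ha, eval_add]

theorem mul_const (hf : ProperRat S f) (c : ℂ) : ProperRat S fun a => f a * c := by
  simpa using hf.mul (const c) (Finset.disjoint_empty_right S)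

theorem const_mul (hf : ProperRat S f) (c : ℂ) : ProperRat S fun a => c * f a := by
  simpa [mul_comm] using hf.mul_const c

theorem sub (hf : ProperRat S f) (hg : ProperRat S g) : ProperRat S fun a => f a - g a := by
  simpa [sub_eq_add_neg] using hf.add (hg.const_mul (-1))

theorem sum {ι : Type*} {I : Finset ι} {f : ι → ℂ → ℂ} (h : ∀ i ∈ I, ProperRat S (f i)) :
    ProperRat S fun a => ∑ i ∈ I, f i a := by
  classical
  induction I using Finset.induction_on with
  | empty => simpa using (const 0).mono (Finset.empty_subset S)
  | insert i I hi ih =>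
    simp only [Finset.sum_insert hi]
    exact (h i (Finset.mem_insert_self _ _)).add
      (ih fun j hj => h j (Finset.mem_insert_of_mem hj))

theorem prod {I : Finset ℂ} {f : ℂ → ℂ → ℂ} (h : ∀ i ∈ I, ProperRat {i} (f i)) :
    ProperRat I fun a => ∏ i ∈ I, f i a := by
  induction I using Finset.induction_on with
  | empty => simpa using const 1
  | insert i I hi ih =>
    simp only [Finset.prod_insert hi]
    exact (h i (Finset.mem_insert_self _ _)).mul
      (ih fun j hj => h j (Finset.mem_insert_of_mem hj)) (by simpa using hi)

theorem linear_div (x y s : ℂ) : ProperRat {s} fun a => (x * a + y) / (a - s) := by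
  refine ⟨C x * X + C y, by rw [Finset.card_singleton]; exact natDegree_linear_le, fun a ha => ?_⟩
  have : a - s ≠ 0 := sub_ne_zero.2 (by simpa using ha)
  simp [this]

/-- A proper rational function with simple poles and vanishing residues is constant. -/
theorem eq_const (hf : ProperRat S f)
    (h : ∀ s ∈ S, Tendsto (fun a => (a - s) * f a) (𝓝[≠] s) (𝓝 0)) :
    ∃ c, ∀ a ∉ S, f a = c := by
  obtain ⟨p, hp, hpe⟩ := hf
  -- The value p(s) is the limit of (a - s) f(a) times the other linear factors. Once it vanishes on
  -- S, the denominator divides p, and the degree bound leaves a constant quotient.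
  have hroot : ∀ s ∈ S, p.eval s = 0 := by
    intro s hs
    have h1 : Tendsto (fun a => p.eval a) (𝓝[≠] s) (𝓝 (p.eval s)) :=
      (p.continuous.tendsto s).mono_left nhdsWithin_le_nhds
    have h2 : Tendsto (fun a => ((a - s) * f a) * ∏ x ∈ S.erase s, (a - x)) (𝓝[≠] s) (𝓝 0) := by
      have h3 : Tendsto (fun a => ∏ x ∈ S.erase s, (a - x)) (𝓝[≠] s)
          (𝓝 (∏ x ∈ S.erase s, (s - x))) :=
        ((by fun_prop : Continuous fun a => ∏ x ∈ S.erase s, (a - x)).tendsto s).mono_left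
          nhdsWithin_le_nhds
      simpa using (h s hs).mul h3
    refine tendsto_nhds_unique (h1.congr' ?_) h2
    have hev : ∀ᶠ a in 𝓝[≠] s, a ∉ S.erase s :=
      (eventually_notMem_finset (Finset.notMem_erase s S)).filter_mono nhdsWithin_le_nhds
    filter_upwards [hev, self_mem_nhdsWithin] with a ha hne
    have haS : a ∉ S := fun h' => ha (Finset.mem_erase.2 ⟨hne, h'⟩)
    rw [← hpe a haS, ← Finset.mul_prod_erase S _ hs]
    ring
  have hdvd : ∏ s ∈ S, (X - C s) ∣ p :=
    Finset.prod_dvd_of_coprime (fun a _ b _ hab => isCoprime_X_sub_C_of_isUnit_sub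
      (sub_ne_zero.2 hab).isUnit) fun s hs => dvd_iff_isRoot.2 (hroot s hs)
  obtain ⟨q, rfl⟩ := hdvd
  have hmonic : (∏ s ∈ S, (X - C s)).Monic := monic_prod_of_monic _ _ fun s _ => monic_X_sub_C s
  have hdeg : (∏ s ∈ S, (X - C s)).natDegree = S.card := by
    rw [natDegree_prod_of_monic _ _ fun s _ => monic_X_sub_C s]
    simp
  have hq : q.natDegree = 0 := by
    rcases eq_or_ne q 0 with rfl | hq0
    · simp
    · rw [hmonic.natDegree_mul' hq0, hdeg] at hp
      omega
  obtain ⟨c, hc⟩ := natDegree_eq_zero.1 hq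
  refine ⟨c, fun a ha => ?_⟩
  have hne : ∏ s ∈ S, (a - s) ≠ 0 := Finset.prod_ne_zero_iff.2 fun s hs => sub_ne_zero.2 fun h' =>
    ha (h' ▸ hs)
  apply mul_right_cancel₀ hne
  rw [hpe a ha, ← hc]
  simp [eval_prod, mul_comm]

end ProperRat

/-! ### The concrete weights; poles and residues of matching sums. -/

/-- The weight of an unmatched pair. -/
noncomputable def pairKernel (t a b : ℂ) : ℂ := (1 - t * a * b) / (a - b)

/-- The weight of a matched pair. -/
noncomputable def pairWeight (t w x y a b : ℂ) : ℂ :=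
  w + (1 - t) * (x * a + y) * (x * b + y) / (1 - a * b)

/-- The weight of a pair of variables in different groups in the symmetrization. -/
noncomputable def crossWeight (t a b : ℂ) : ℂ := (a - t * b) / (a - b)

theorem pairKernel_antisymm (t a b : ℂ) : pairKernel t a b = -pairKernel t b a := by
  rw [pairKernel, pairKernel, ← neg_sub b a, div_neg, mul_right_comm]

theorem pairWeight_comm (t w x y a b : ℂ) : pairWeight t w x y a b = pairWeight t w x y b a := by
  rw [pairWeight, pairWeight, mul_comm a b, mul_right_comm]

/-- A set of variables no two of which, equal or not, have product `1`. -/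
def Nonreciprocal (U : Finset ℂ) : Prop := ∀ a ∈ U, ∀ b ∈ U, a * b ≠ 1

theorem Nonreciprocal.mono {U V : Finset ℂ} (h : Nonreciprocal U) (hV : V ⊆ U) :
    Nonreciprocal V := fun a ha b hb => h a (hV ha) b (hV hb)

/-- The possible poles of `matchSum` in one more variable. -/
noncomputable def poleSet (V : Finset ℂ) : Finset ℂ := V ∪ V.image fun b => b⁻¹

theorem ProperRat.pairKernel (t j : ℂ) : ProperRat {j} fun a => pairKernel t a j :=
  (ProperRat.linear_div (-t * j) 1 j).congr fun a _ => by
    rw [_root_.pairKernel]; ring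

theorem ProperRat.crossWeight_left (t j : ℂ) : ProperRat {j} fun a => crossWeight t a j :=
  (ProperRat.linear_div 1 (-t * j) j).congr fun a _ => by
    rw [crossWeight]; ring

theorem ProperRat.crossWeight_right (t j : ℂ) : ProperRat {j} fun a => crossWeight t j a :=
  (ProperRat.linear_div t (-j) j).congr fun a _ => by
    rw [crossWeight, ← neg_sub a j, div_neg, ← neg_div]; ring

/-- For b = 0 the weight is affine in a, in general unbounded at infinity; hence the variable 0 is
kept out of the fixed set throughout the residue argument. -/
theorem ProperRat.pairWeight (t w x y : ℂ) {b : ℂ} (hb : b ≠ 0) :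
    ProperRat {b⁻¹} fun a => pairWeight t w x y a b := by
  have h := (ProperRat.linear_div x y b⁻¹).mul_const (-((1 - t) * (x * b + y) / b))
  refine (((ProperRat.const w).mono (Finset.empty_subset _)).add h).congr fun a ha => ?_
  have h1 : a - b⁻¹ ≠ 0 := sub_ne_zero.2 (by simpa using ha)
  have h2 : 1 - a * b = -b * (a - b⁻¹) := by field_simp; ring
  rw [_root_.pairWeight, h2]
  field_simp

/-- `pairWeight` still bounded at infinity after multiplication by a linear factor. -/
theorem ProperRat.linear_mul_pairWeight (t s : ℂ) {b : ℂ} (hb : b ≠ 0) :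
    ProperRat {b⁻¹} fun a => (a - s) * _root_.pairWeight t 0 0 1 a b := by
  have h := (ProperRat.linear_div 1 (-s) b⁻¹).mul_const (-((1 - t) / b))
  refine h.congr fun a ha => ?_
  have h1 : a - b⁻¹ ≠ 0 := sub_ne_zero.2 (by simpa using ha)
  have h2 : 1 - a * b = -b * (a - b⁻¹) := by field_simp; ring
  rw [_root_.pairWeight, h2]
  field_simp
  ring

theorem inv_notMem_of_nonreciprocal {V : Finset ℂ} (hV : Nonreciprocal V) {b : ℂ} (hb : b ∈ V)
    (h0 : b ≠ 0) : b⁻¹ ∉ V := fun h => hV b hb _ h (mul_inv_cancel₀ h0)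

theorem matchSum_properRat (t w x y : ℂ) {V : Finset ℂ} (hV : Nonreciprocal V) (h0 : (0 : ℂ) ∉ V) :
    ProperRat (poleSet V)
      fun a => matchSum (pairKernel t) (pairWeight t w x y) (insert a V) := by
  have : ProperRat (poleSet V) fun a => ∑ b ∈ V, pairWeight t w x y a b *
      (∏ j ∈ V.erase b, pairKernel t a j) *
      ((∏ j ∈ V.erase b, pairKernel t b j) *
        matchSum (pairKernel t) (pairWeight t w x y) (V.erase b)) := by
    refine ProperRat.sum fun b hb => ProperRat.mul_const ?_ _
    have hb0 : b ≠ 0 := fun h => h0 (h ▸ hb)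
    refine ((ProperRat.pairWeight t w x y hb0).mul
      (ProperRat.prod fun j _ => ProperRat.pairKernel t j) ?_).mono ?_
    · rw [Finset.disjoint_singleton_left]
      exact fun h => inv_notMem_of_nonreciprocal hV hb hb0 (Finset.mem_of_mem_erase h)
    · refine Finset.union_subset ?_ ?_
      · rw [Finset.singleton_subset_iff]
        exact Finset.mem_union_right _ (Finset.mem_image_of_mem _ hb)
      · exact (Finset.erase_subset _ _).trans Finset.subset_union_left
  refine this.congr fun a ha => ?_
  rw [matchSum_expand_insert (pairKernel_antisymm t) (pairWeight_comm t w x y)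
    fun h => ha (Finset.mem_union_left _ h)]
  refine Finset.sum_congr rfl fun b hb => ?_
  rw [Finset.prod_mul_distrib]
  ring

section
open Filter Topology

theorem continuousAt_pairKernel (t : ℂ) {b j : ℂ} (h : b ≠ j) :
    ContinuousAt (fun a => pairKernel t a j) b := by
  unfold pairKernel
  exact ContinuousAt.div (by fun_prop) (by fun_prop) (sub_ne_zero.2 h)

theorem continuousAt_pairWeight (t w x y : ℂ) {b c : ℂ} (h : b * c ≠ 1) :
    ContinuousAt (fun a => pairWeight t w x y a c) b := by
  unfold pairWeight
  exact continuousAt_const.add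
    (ContinuousAt.div (by fun_prop) (by fun_prop) (sub_ne_zero.2 (Ne.symm h)))

theorem continuousAt_crossWeight_left (t : ℂ) {b j : ℂ} (h : b ≠ j) :
    ContinuousAt (fun a => crossWeight t a j) b := by
  unfold crossWeight
  exact ContinuousAt.div (by fun_prop) (by fun_prop) (sub_ne_zero.2 h)

theorem continuousAt_crossWeight_right (t : ℂ) {b j : ℂ} (h : b ≠ j) :
    ContinuousAt (fun a => crossWeight t j a) b := by
  unfold crossWeight
  exact ContinuousAt.div (by fun_prop) (by fun_prop) (sub_ne_zero.2 (Ne.symm h))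

theorem continuousAt_finsetProd {ι : Type*} {I : Finset ι} {f : ι → ℂ → ℂ} {b : ℂ}
    (h : ∀ i ∈ I, ContinuousAt (f i) b) : ContinuousAt (fun a => ∏ i ∈ I, f i a) b :=
  tendsto_finsetProd I h

theorem continuousAt_finsetSum {ι : Type*} {I : Finset ι} {f : ι → ℂ → ℂ} {b : ℂ}
    (h : ∀ i ∈ I, ContinuousAt (f i) b) : ContinuousAt (fun a => ∑ i ∈ I, f i a) b :=
  tendsto_finsetSum I h

theorem continuousAt_prod_pairKernel (t : ℂ) (d : ℂ) {b : ℂ} {I : Finset ℂ} (h : b ∉ I) :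
    ContinuousAt (fun a => ∏ j ∈ I, pairKernel t a j * pairKernel t d j) b :=
  continuousAt_finsetProd fun _ hj =>
    (continuousAt_pairKernel t (ne_of_mem_of_not_mem hj h).symm).mul continuousAt_const

theorem continuousAt_matchSum_insert (t w x y : ℂ) {V : Finset ℂ} {b : ℂ} (hb : b ∉ V)
    (hbV : ∀ c ∈ V, b * c ≠ 1) :
    ContinuousAt (fun a => matchSum (pairKernel t) (pairWeight t w x y) (insert a V)) b := by
  have h : ContinuousAt (fun a => ∑ c ∈ V, pairWeight t w x y a c *
      (∏ j ∈ V.erase c, pairKernel t a j * pairKernel t c j) *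
        matchSum (pairKernel t) (pairWeight t w x y) (V.erase c)) b :=
    continuousAt_finsetSum fun c hc =>
      ((continuousAt_pairWeight t w x y (hbV c hc)).mul (continuousAt_prod_pairKernel t c
        fun h => hb (Finset.mem_of_mem_erase h))).mul continuousAt_const
  refine h.congr ?_
  filter_upwards [eventually_notMem_finset hb] with a ha
  rw [matchSum_expand_insert (pairKernel_antisymm t) (pairWeight_comm t w x y) ha]

theorem tendsto_of_eventuallyEq_continuousAt {f g : ℂ → ℂ} {b c : ℂ} (hg : ContinuousAt g b)
    (hc : g b = c) (h : ∀ᶠ a in 𝓝[≠] b, f a = g a) : Tendsto f (𝓝[≠] b) (𝓝 c) := by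
  rw [← hc]
  exact (hg.tendsto.mono_left nhdsWithin_le_nhds).congr' (h.mono fun _ h => h.symm)

theorem eventually_punctured_notMem {V : Finset ℂ} {b : ℂ} :
    ∀ᶠ a in 𝓝[≠] b, a ∉ V := by
  have h : ∀ᶠ a in 𝓝[≠] b, a ∉ V.erase b :=
    (eventually_notMem_finset (Finset.notMem_erase b V)).filter_mono nhdsWithin_le_nhds
  filter_upwards [h, self_mem_nhdsWithin] with a ha hab
  exact fun h' => ha (Finset.mem_erase.2 ⟨hab, h'⟩)

theorem sum_sum_erase_eq_zero {X : Finset ℂ} {T : ℂ → ℂ → ℂ} (h : ∀ c d, T c d = -T d c) :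
    ∑ c ∈ X, ∑ d ∈ X.erase c, T c d = 0 := by
  have h1 : ∑ c ∈ X, ∑ d ∈ X.erase c, T c d = ∑ d ∈ X, ∑ c ∈ X.erase d, T c d :=
    Finset.sum_comm' fun x y => by simp only [Finset.mem_erase]; tauto
  have h2 : ∑ d ∈ X, ∑ c ∈ X.erase d, T c d = -∑ c ∈ X, ∑ d ∈ X.erase c, T c d := by
    simp_rw [← Finset.sum_neg_distrib]
    exact Finset.sum_congr rfl fun d _ => Finset.sum_congr rfl fun c _ => h c d
  rw [h2] at h1
  exact self_eq_neg.1 h1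

/-- `matchSum` has no pole where two variables coincide. -/
theorem tendsto_matchSum_coincide (t w x y : ℂ) {X : Finset ℂ} {b : ℂ} (hb : b ∉ X)
    (hX : Nonreciprocal (insert b X)) :
    Tendsto (fun a => (a - b) * matchSum (pairKernel t) (pairWeight t w x y)
      (insert a (insert b X))) (𝓝[≠] b) (𝓝 0) := by
  set K := pairKernel t with hK
  set N := pairWeight t w x y with hN
  have hb' : b ∈ insert b X := Finset.mem_insert_self b X
  have hmem : ∀ c ∈ X, c ∈ insert b X := fun c hc => Finset.mem_insert_of_mem hc
  have hne : ∀ c ∈ X, b ≠ c := fun c hc e => hb (e ▸ hc)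
  -- Expand along a. If a is matched with b, the factor a - b survives; otherwise it cancels the
  -- pole of K a b and leaves 1 - tab. Either way the expression is continuous at b.
  refine tendsto_of_eventuallyEq_continuousAt (g := fun a =>
    (a - b) * (N a b * (∏ j ∈ X, K a j * K b j) * matchSum K N X) +
      ∑ c ∈ X, N a c * (1 - t * a * b) * K c b * (∏ j ∈ X.erase c, K a j * K c j) *
        matchSum K N (insert b (X.erase c))) ?_ ?_ ?_
  · refine ContinuousAt.add ?_ (continuousAt_finsetSum fun c hc => ?_)
    · refine ContinuousAt.mul (by fun_prop) (ContinuousAt.mul ?_ continuousAt_const)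
      exact (continuousAt_pairWeight t w x y (hX b hb' b hb')).mul
        (continuousAt_prod_pairKernel t b hb)
    · refine ContinuousAt.mul (ContinuousAt.mul (ContinuousAt.mul (ContinuousAt.mul ?_ ?_) ?_) ?_)
        continuousAt_const
      · exact continuousAt_pairWeight t w x y (hX b hb' c (hmem c hc))
      · fun_prop
      · exact continuousAt_const
      · exact continuousAt_prod_pairKernel t c fun h => hb (Finset.mem_of_mem_erase h)
  · simp only [sub_self, zero_mul, zero_add]
    -- At a = b, expand the rest along b. The two copies of b are then matched with c and d, and
    -- exchanging c with d changes the sign.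
    have := sum_sum_erase_eq_zero (X := X) (T := fun c d => N b c * N b d * (1 - t * b * b) *
      (K c b * K b d * K c d) * (∏ j ∈ (X.erase c).erase d, K b j * K c j * (K b j * K d j)) *
        matchSum K N ((X.erase c).erase d)) (by
      intro c d
      rw [Finset.erase_right_comm, hK, pairKernel_antisymm t c b, pairKernel_antisymm t b d,
        pairKernel_antisymm t c d]
      simp_rw [mul_mul_mul_comm _ (pairKernel t c _), mul_comm (pairKernel t c _)]
      simp_rw [mul_mul_mul_comm _ _ (pairKernel t b _) (pairKernel t c _)]
      ring)
    rw [← this]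
    refine Finset.sum_congr rfl fun c hc => ?_
    rw [matchSum_expand_insert (pairKernel_antisymm t) (pairWeight_comm t w x y)
      (fun h => hb (Finset.mem_of_mem_erase h)), Finset.mul_sum]
    refine Finset.sum_congr rfl fun d hd => ?_
    rw [← Finset.mul_prod_erase _ _ hd, Finset.prod_mul_distrib (f := fun j => K b j * K c j)]
    ring
  · filter_upwards [eventually_punctured_notMem (V := insert b X)] with a ha
    have hab : a - b ≠ 0 := sub_ne_zero.2 fun h => ha (h ▸ hb')
    rw [matchSum_expand_insert (pairKernel_antisymm t) (pairWeight_comm t w x y) ha,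
      Finset.sum_insert hb, Finset.erase_insert hb, mul_add, Finset.mul_sum]
    congr 1
    refine Finset.sum_congr rfl fun c hc => ?_
    rw [Finset.erase_insert_of_ne (hne c hc), Finset.prod_insert
      (fun h => hb (Finset.mem_of_mem_erase h))]
    have : (a - b) * K a b = 1 - t * a * b := by
      rw [hK, pairKernel]; field_simp
    rw [← this]
    ring

/-- The residue of `matchSum` at the reciprocal of a variable. -/
theorem tendsto_matchSum_reciprocal (t w x y : ℂ) {X : Finset ℂ} {b : ℂ} (hb : b ∉ X)
    (hX : Nonreciprocal (insert b X)) (h0 : b ≠ 0) :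
    Tendsto (fun a => (a - b⁻¹) * matchSum (pairKernel t) (pairWeight t w x y)
      (insert a (insert b X))) (𝓝[≠] b⁻¹)
      (𝓝 (-(1 - t) / b * ((x * b⁻¹ + y) * (x * b + y)) *
        (∏ j ∈ X, pairKernel t b⁻¹ j * pairKernel t b j) *
          matchSum (pairKernel t) (pairWeight t w x y) X)) := by
  set K := pairKernel t with hK
  set N := pairWeight t w x y with hN
  have hb' : b ∈ insert b X := Finset.mem_insert_self b X
  have hinv : b⁻¹ ∉ insert b X := inv_notMem_of_nonreciprocal hX hb' h0
  have hne : ∀ c ∈ X, b ≠ c := fun c hc e => hb (e ▸ hc)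
  -- Only the pair {a, b} is singular at b⁻¹; all other terms keep the factor a - b⁻¹.
  refine tendsto_of_eventuallyEq_continuousAt (g := fun a =>
    ((a - b⁻¹) * w - (1 - t) / b * (x * a + y) * (x * b + y)) * (∏ j ∈ X, K a j * K b j) *
      matchSum K N X + (a - b⁻¹) *
      ∑ c ∈ X, N a c * (∏ j ∈ (insert b X).erase c, K a j * K c j) *
        matchSum K N ((insert b X).erase c)) ?_ ?_ ?_
  · refine ContinuousAt.add ?_ (ContinuousAt.mul (by fun_prop)
      (continuousAt_finsetSum fun c hc => ?_))
    · exact (ContinuousAt.mul (by fun_prop) (continuousAt_prod_pairKernel t b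
        fun h => hinv (Finset.mem_insert_of_mem h))).mul continuousAt_const
    · refine ContinuousAt.mul (ContinuousAt.mul (continuousAt_pairWeight t w x y ?_)
        (continuousAt_prod_pairKernel t c fun h => hinv (Finset.mem_of_mem_erase h)))
        continuousAt_const
      intro h
      exact hne c hc (by field_simp at h; exact h.symm)
  · simp only [sub_self, zero_mul, zero_sub, add_zero]
    ring
  · filter_upwards [eventually_punctured_notMem (V := insert b X), self_mem_nhdsWithin]
      with a ha hab
    have hab : a - b⁻¹ ≠ 0 := sub_ne_zero.2 hab
    rw [matchSum_expand_insert (pairKernel_antisymm t) (pairWeight_comm t w x y) ha,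
      Finset.sum_insert hb, Finset.erase_insert hb, mul_add]
    congr 1
    have h2 : 1 - a * b = -b * (a - b⁻¹) := by field_simp; ring
    have : (a - b⁻¹) * N a b = (a - b⁻¹) * w - (1 - t) / b * (x * a + y) * (x * b + y) := by
      rw [hN, pairWeight, h2]
      generalize a - b⁻¹ = d at hab
      field_simp
      ring
    rw [← this]
    ring

end

/-! ### The finite sum over subsets, and its poles and residues. -/

section
open Filter Topology

/-- The unrefined matching sum: the Littlewood-type Pfaffian. -/
noncomputable def littlewoodPf (t : ℂ) (U : Finset ℂ) : ℂ :=
  matchSum (pairKernel t) (pairWeight t 0 0 1) U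

/-- The refined matching sum. -/
noncomputable def refinedPf (t s w : ℂ) (U : Finset ℂ) : ℂ :=
  matchSum (pairKernel t) (pairWeight t w 1 (-s)) U

/-- The weight of `2 * k` parts of size `0`. -/
noncomputable def levelCoeff (t s w : ℂ) (k : ℕ) : ℂ :=
  ∏ l ∈ Finset.range k, ((1 - t ^ (2 * l)) * (1 - s ^ 2 * t ^ (2 * l + 1)) + w * t ^ (2 * l))

/-- The weight of the variables `J` being above level `0`, the others being on level `0`. -/
noncomputable def splitWeight (t s : ℂ) (U J : Finset ℂ) : ℂ :=
  (∏ j ∈ J, (j - s)) * ∏ j ∈ J, ∏ i ∈ U \ J, crossWeight t j i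

/-- The sum over all ways to choose the variables above level `0`. -/
noncomputable def levelSum (t s w : ℂ) (U : Finset ℂ) : ℂ :=
  ∑ J ∈ U.powerset, levelCoeff t s w ((U.card - J.card) / 2) * splitWeight t s U J *
    littlewoodPf t J

section
variable {t s w : ℂ} {V J : Finset ℂ} {a : ℂ}

theorem splitWeight_insert_left (ha : a ∉ V) (hJ : J ⊆ V) :
    splitWeight t s (insert a V) J = splitWeight t s V J * ∏ j ∈ J, crossWeight t j a := by
  have haJ : a ∉ V \ J := fun h => ha (Finset.mem_sdiff.1 h).1
  rw [splitWeight, splitWeight, Finset.insert_sdiff_of_notMem _ fun h => ha (hJ h)]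
  simp only [Finset.prod_insert haJ, Finset.prod_mul_distrib]
  ring

theorem splitWeight_insert_insert (ha : a ∉ V) (hJ : J ⊆ V) :
    splitWeight t s (insert a V) (insert a J) =
      splitWeight t s V J * ((a - s) * ∏ i ∈ V \ J, crossWeight t a i) := by
  have h : insert a V \ insert a J = V \ J := by
    ext x
    simp only [Finset.mem_sdiff, Finset.mem_insert, not_or]
    constructor
    · rintro ⟨h1 | h1, h2, h3⟩
      · exact absurd h1 h2
      · exact ⟨h1, h3⟩
    · rintro ⟨h1, h2⟩
      exact ⟨Or.inr h1, fun h => ha (h ▸ h1), h2⟩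
  rw [splitWeight, splitWeight, h, Finset.prod_insert fun h => ha (hJ h),
    Finset.prod_insert fun h => ha (hJ h)]
  ring

theorem levelSum_insert (ha : a ∉ V) : levelSum t s w (insert a V) = ∑ J ∈ V.powerset,
    (levelCoeff t s w ((V.card + 1 - J.card) / 2) * splitWeight t s V J *
      (∏ j ∈ J, crossWeight t j a) * littlewoodPf t J +
    levelCoeff t s w ((V.card - J.card) / 2) * splitWeight t s V J *
      (∏ i ∈ V \ J, crossWeight t a i) * ((a - s) * littlewoodPf t (insert a J))) := by
  rw [levelSum, Finset.sum_powerset_insert ha, ← Finset.sum_add_distrib]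
  refine Finset.sum_congr rfl fun J hJ => ?_
  rw [Finset.mem_powerset] at hJ
  rw [splitWeight_insert_left ha hJ, splitWeight_insert_insert ha hJ,
    Finset.card_insert_of_notMem ha, Finset.card_insert_of_notMem fun h => ha (hJ h),
    Nat.add_sub_add_right]
  ring

/-- The four positions of a and b relative to level 0 are collected over a common subset Y of the
other variables, since poles at a = b cancel only within such a group. -/
theorem levelSum_insert_insert {X : Finset ℂ} {b : ℂ} (hb : b ∉ X) (ha : a ∉ insert b X) :
    levelSum t s w (insert a (insert b X)) = ∑ Y ∈ X.powerset, splitWeight t s X Y * (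
      levelCoeff t s w ((X.card + 2 - Y.card) / 2) *
        ((∏ y ∈ Y, crossWeight t y a) * (∏ y ∈ Y, crossWeight t y b)) * littlewoodPf t Y +
      levelCoeff t s w ((X.card + 1 - Y.card) / 2) *
        ((b - s) * (∏ i ∈ X \ Y, crossWeight t b i) * crossWeight t b a *
          (∏ y ∈ Y, crossWeight t y a) * littlewoodPf t (insert b Y) +
        (a - s) * (∏ i ∈ X \ Y, crossWeight t a i) * crossWeight t a b *
          (∏ y ∈ Y, crossWeight t y b) * littlewoodPf t (insert a Y)) +
      levelCoeff t s w ((X.card - Y.card) / 2) * ((a - s) * (b - s) *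
        ((∏ i ∈ X \ Y, crossWeight t a i) * (∏ i ∈ X \ Y, crossWeight t b i))) *
          littlewoodPf t (insert a (insert b Y))) := by
  rw [levelSum_insert ha, Finset.sum_powerset_insert hb, ← Finset.sum_add_distrib]
  refine Finset.sum_congr rfl fun Y hY => ?_
  rw [Finset.mem_powerset] at hY
  have hbY : b ∉ Y := fun h => hb (hY h)
  have h : insert b X \ insert b Y = X \ Y := by
    rw [Finset.insert_sdiff_insert, Finset.sdiff_insert_of_notMem hb]
  rw [splitWeight_insert_left hb hY, splitWeight_insert_insert hb hY, h,
    Finset.card_insert_of_notMem hb, Finset.card_insert_of_notMem hbY,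
    Finset.insert_sdiff_of_notMem _ hbY, Finset.prod_insert fun h => hb (Finset.mem_sdiff.1 h).1,
    Finset.prod_insert hbY, Nat.add_sub_add_right, Nat.add_sub_add_right]
  ring

theorem subset_poleSet (V : Finset ℂ) : V ⊆ poleSet V := Finset.subset_union_left

theorem inv_mem_poleSet {b : ℂ} (hb : b ∈ V) : b⁻¹ ∈ poleSet V :=
  Finset.mem_union_right _ (Finset.mem_image_of_mem _ hb)

theorem poleSet_mono (h : J ⊆ V) : poleSet J ⊆ poleSet V :=
  Finset.union_subset_union h (Finset.image_subset_image h)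

/-- The factor `littlewoodPf` has its poles in `poleSet J`, the cross weights in `V \ J`;
disjointness makes the poles of their product simple. -/
theorem disjoint_poleSet_sdiff (hV : Nonreciprocal V) (h0 : (0 : ℂ) ∉ V) (hJ : J ⊆ V) :
    Disjoint (poleSet J) (V \ J) := by
  rw [Finset.disjoint_left]
  intro x hx hxV
  rw [Finset.mem_sdiff] at hxV
  rcases Finset.mem_union.1 hx with h | h
  · exact hxV.2 h
  · obtain ⟨b, hb, rfl⟩ := Finset.mem_image.1 h
    exact inv_notMem_of_nonreciprocal hV (hJ hb) (fun h => h0 (h ▸ hJ hb)) hxV.1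

/-- For w = x = 0 and y = 1 the pair weight decays like 1/a when b ≠ 0, which compensates the growth
of a - s. -/
theorem linear_mul_littlewoodPf_properRat (t s : ℂ) (hV : Nonreciprocal V) (h0 : (0 : ℂ) ∉ V) :
    ProperRat (poleSet V) fun a => (a - s) * littlewoodPf t (insert a V) := by
  have : ProperRat (poleSet V) fun a => ∑ b ∈ V, ((a - s) * pairWeight t 0 0 1 a b) *
      (∏ j ∈ V.erase b, pairKernel t a j) *
      ((∏ j ∈ V.erase b, pairKernel t b j) * littlewoodPf t (V.erase b)) := by
    refine ProperRat.sum fun b hb => ProperRat.mul_const ?_ _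
    have hb0 : b ≠ 0 := fun h => h0 (h ▸ hb)
    refine ((ProperRat.linear_mul_pairWeight t s hb0).mul
      (ProperRat.prod fun j _ => ProperRat.pairKernel t j) ?_).mono ?_
    · rw [Finset.disjoint_singleton_left]
      exact fun h => inv_notMem_of_nonreciprocal hV hb hb0 (Finset.mem_of_mem_erase h)
    · exact Finset.union_subset (Finset.singleton_subset_iff.2 (inv_mem_poleSet hb))
        ((Finset.erase_subset _ _).trans (subset_poleSet V))
  refine this.congr fun a ha => ?_
  rw [littlewoodPf, matchSum_expand_insert (pairKernel_antisymm t) (pairWeight_comm t 0 0 1)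
    fun h => ha (subset_poleSet V h), Finset.mul_sum]
  refine Finset.sum_congr rfl fun b hb => ?_
  rw [Finset.prod_mul_distrib, littlewoodPf]
  ring

theorem levelSum_properRat (t s w : ℂ) (hV : Nonreciprocal V) (h0 : (0 : ℂ) ∉ V) :
    ProperRat (poleSet V) fun a => levelSum t s w (insert a V) := by
  refine ProperRat.congr (ProperRat.sum (I := V.powerset) (f := fun J a =>
    (∏ j ∈ J, crossWeight t j a) * (levelCoeff t s w ((V.card + 1 - J.card) / 2) *
      splitWeight t s V J * littlewoodPf t J) +
    ((a - s) * littlewoodPf t (insert a J)) * (∏ i ∈ V \ J, crossWeight t a i) *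
      (levelCoeff t s w ((V.card - J.card) / 2) * splitWeight t s V J)) fun J hJ => ?_) ?_
  · rw [Finset.mem_powerset] at hJ
    have hJ0 : (0 : ℂ) ∉ J := fun h => h0 (hJ h)
    refine ProperRat.add (ProperRat.mul_const ?_ _) (ProperRat.mul_const ?_ _)
    · exact (ProperRat.prod fun j _ => ProperRat.crossWeight_right t j).mono
        (hJ.trans (subset_poleSet V))
    · refine ((linear_mul_littlewoodPf_properRat t s (hV.mono hJ) hJ0).mul
        (ProperRat.prod fun j _ => ProperRat.crossWeight_left t j)
        (disjoint_poleSet_sdiff hV h0 hJ)).mono ?_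
      exact Finset.union_subset (poleSet_mono hJ) (Finset.sdiff_subset.trans (subset_poleSet V))
  · intro a ha
    rw [levelSum_insert fun h => ha (subset_poleSet V h)]
    exact Finset.sum_congr rfl fun J _ => by ring

theorem continuousAt_littlewoodPf_insert (t : ℂ) {b : ℂ} (hb : b ∉ V)
    (hbV : ∀ c ∈ V, b * c ≠ 1) : ContinuousAt (fun a => littlewoodPf t (insert a V)) b :=
  continuousAt_matchSum_insert t 0 0 1 hb hbV

theorem continuousAt_prod_crossWeight_left (t : ℂ) {b : ℂ} (hb : b ∉ V) :
    ContinuousAt (fun a => ∏ i ∈ V, crossWeight t a i) b :=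
  continuousAt_finsetProd fun _ hi =>
    continuousAt_crossWeight_left t (ne_of_mem_of_not_mem hi hb).symm

theorem continuousAt_prod_crossWeight_right (t : ℂ) {b : ℂ} (hb : b ∉ V) :
    ContinuousAt (fun a => ∏ i ∈ V, crossWeight t i a) b :=
  continuousAt_finsetProd fun _ hi =>
    continuousAt_crossWeight_right t (ne_of_mem_of_not_mem hi hb).symm

theorem tendsto_punctured_of_continuousAt {g : ℂ → ℂ} {b c : ℂ} (hg : ContinuousAt g b)
    (hc : g b = c) : Tendsto g (𝓝[≠] b) (𝓝 c) :=
  hc ▸ hg.tendsto.mono_left nhdsWithin_le_nhds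

theorem ContinuousAt.tendsto_punctured {g : ℂ → ℂ} {b : ℂ} (hg : ContinuousAt g b) :
    Tendsto g (𝓝[≠] b) (𝓝 (g b)) := hg.tendsto.mono_left nhdsWithin_le_nhds

/-- `levelSum` has no pole where two variables coincide. -/
theorem tendsto_levelSum_coincide (t s w : ℂ) {X : Finset ℂ} {b : ℂ} (hb : b ∉ X)
    (hX : Nonreciprocal (insert b X)) :
    Tendsto (fun a => (a - b) * levelSum t s w (insert a (insert b X))) (𝓝[≠] b) (𝓝 0) := by
  have hb' : b ∈ insert b X := Finset.mem_insert_self b X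
  have main : ∀ Y ∈ X.powerset, Tendsto (fun a => splitWeight t s X Y * (
      (a - b) * (levelCoeff t s w ((X.card + 2 - Y.card) / 2) *
        ((∏ y ∈ Y, crossWeight t y a) * (∏ y ∈ Y, crossWeight t y b)) * littlewoodPf t Y) +
      levelCoeff t s w ((X.card + 1 - Y.card) / 2) *
        ((b - s) * (∏ i ∈ X \ Y, crossWeight t b i) * (t * a - b) *
          (∏ y ∈ Y, crossWeight t y a) * littlewoodPf t (insert b Y) +
        (a - s) * (∏ i ∈ X \ Y, crossWeight t a i) * (a - t * b) *
          (∏ y ∈ Y, crossWeight t y b) * littlewoodPf t (insert a Y)) +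
      levelCoeff t s w ((X.card - Y.card) / 2) * ((a - s) * (b - s) *
        ((∏ i ∈ X \ Y, crossWeight t a i) * (∏ i ∈ X \ Y, crossWeight t b i))) *
          ((a - b) * littlewoodPf t (insert a (insert b Y))))) (𝓝[≠] b) (𝓝 0) := by
    intro Y hY
    rw [Finset.mem_powerset] at hY
    have hbY : b ∉ Y := fun h => hb (hY h)
    have hbXY : b ∉ X \ Y := fun h => hb (Finset.mem_sdiff.1 h).1
    have hsub : insert b Y ⊆ insert b X := Finset.insert_subset_insert b hY
    have c1 := continuousAt_prod_crossWeight_left t hbXY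
    have c2 := continuousAt_prod_crossWeight_right t hbY
    have c3 := continuousAt_littlewoodPf_insert t hbY
      fun c hc => hX b hb' c (hsub (Finset.mem_insert_of_mem hc))
    have h1 : Tendsto (fun a => (a - b) * (levelCoeff t s w ((X.card + 2 - Y.card) / 2) *
        ((∏ y ∈ Y, crossWeight t y a) * (∏ y ∈ Y, crossWeight t y b)) * littlewoodPf t Y))
        (𝓝[≠] b) (𝓝 0) := by
      refine tendsto_punctured_of_continuousAt ?_ ?_
      · exact ContinuousAt.mul (by fun_prop) (((c2.mul_const _).const_mul _).mul_const _)
      · simp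
    -- Exactly one of a, b is above level 0. The two choices have opposite residues, from the
    -- factors tb - b and b - tb.
    have h2 : Tendsto (fun a => levelCoeff t s w ((X.card + 1 - Y.card) / 2) *
        ((b - s) * (∏ i ∈ X \ Y, crossWeight t b i) * (t * a - b) *
          (∏ y ∈ Y, crossWeight t y a) * littlewoodPf t (insert b Y) +
        (a - s) * (∏ i ∈ X \ Y, crossWeight t a i) * (a - t * b) *
          (∏ y ∈ Y, crossWeight t y b) * littlewoodPf t (insert a Y))) (𝓝[≠] b) (𝓝 0) := by
      refine tendsto_punctured_of_continuousAt (ContinuousAt.const_mul (ContinuousAt.add ?_ ?_) _) ?_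
      · exact ((ContinuousAt.mul (by fun_prop) c2)).mul_const _
      · exact (((ContinuousAt.mul (by fun_prop) c1).mul (by fun_prop)).mul_const _).mul c3
      · ring
    have h3 : Tendsto (fun a => (a - b) * littlewoodPf t (insert a (insert b Y))) (𝓝[≠] b) (𝓝 0) :=
      tendsto_matchSum_coincide t 0 0 1 hbY (hX.mono hsub)
    have h4 : ContinuousAt (fun a => levelCoeff t s w ((X.card - Y.card) / 2) * ((a - s) * (b - s) *
        ((∏ i ∈ X \ Y, crossWeight t a i) * (∏ i ∈ X \ Y, crossWeight t b i)))) b :=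
      (ContinuousAt.mul (by fun_prop) (c1.mul_const _)).const_mul _
    have h5 := ((h1.add h2).add (h4.tendsto_punctured.mul h3)).const_mul (splitWeight t s X Y)
    simpa using h5
  have h := tendsto_finsetSum X.powerset main
  rw [Finset.sum_const_zero] at h
  refine h.congr' ?_
  filter_upwards [eventually_punctured_notMem (V := insert b X)] with a ha
  rw [levelSum_insert_insert hb ha, Finset.mul_sum]
  refine Finset.sum_congr rfl fun Y _ => ?_
  have hab : a - b ≠ 0 := sub_ne_zero.2 fun h => ha (h ▸ hb')
  have e1 : t * a - b = (a - b) * crossWeight t b a := by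
    rw [crossWeight, ← neg_sub a b]; field_simp; ring
  have e2 : a - t * b = (a - b) * crossWeight t a b := by
    rw [crossWeight]; field_simp
  rw [e1, e2]
  ring

/-- The numerators are exchanged: 1 - tb⁻¹y = b⁻¹(b - ty) and 1 - tby = b(b⁻¹ - ty). Thus variables
on level 0 contribute to the residue the same factor as those above it. -/
theorem pairKernel_inv_mul {b y : ℂ} (h0 : b ≠ 0) (h1 : b ≠ y) (h2 : b⁻¹ ≠ y) :
    pairKernel t b⁻¹ y * pairKernel t b y = crossWeight t b⁻¹ y * crossWeight t b y := by
  have h1' : b - y ≠ 0 := sub_ne_zero.2 h1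
  have h2' : b⁻¹ - y ≠ 0 := sub_ne_zero.2 h2
  rw [pairKernel, pairKernel, crossWeight, crossWeight, div_mul_div_comm, div_mul_div_comm]
  congr 1
  field_simp

/-- The residue of `levelSum` at the reciprocal of a variable. -/
theorem tendsto_levelSum_reciprocal (t s w : ℂ) {X : Finset ℂ} {b : ℂ} (hb : b ∉ X)
    (hX : Nonreciprocal (insert b X)) (h0 : b ≠ 0) :
    Tendsto (fun a => (a - b⁻¹) * levelSum t s w (insert a (insert b X))) (𝓝[≠] b⁻¹)
      (𝓝 (-(1 - t) / b * ((b⁻¹ - s) * (b - s)) *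
        (∏ j ∈ X, pairKernel t b⁻¹ j * pairKernel t b j) * levelSum t s w X)) := by
  have hb' : b ∈ insert b X := Finset.mem_insert_self b X
  have hinv : b⁻¹ ∉ insert b X := inv_notMem_of_nonreciprocal hX hb' h0
  have hinvX : b⁻¹ ∉ X := fun h => hinv (Finset.mem_insert_of_mem h)
  have hbb : b⁻¹ ≠ b := fun h => hinv (by rw [h]; exact hb')
  have main : ∀ Y ∈ X.powerset, Tendsto (fun a => splitWeight t s X Y * (
      (a - b⁻¹) * (levelCoeff t s w ((X.card + 2 - Y.card) / 2) *
        ((∏ y ∈ Y, crossWeight t y a) * (∏ y ∈ Y, crossWeight t y b)) * littlewoodPf t Y +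
      levelCoeff t s w ((X.card + 1 - Y.card) / 2) *
        ((b - s) * (∏ i ∈ X \ Y, crossWeight t b i) * crossWeight t b a *
          (∏ y ∈ Y, crossWeight t y a) * littlewoodPf t (insert b Y) +
        (a - s) * (∏ i ∈ X \ Y, crossWeight t a i) * crossWeight t a b *
          (∏ y ∈ Y, crossWeight t y b) * littlewoodPf t (insert a Y))) +
      levelCoeff t s w ((X.card - Y.card) / 2) * ((a - s) * (b - s) *
        ((∏ i ∈ X \ Y, crossWeight t a i) * (∏ i ∈ X \ Y, crossWeight t b i))) *
          ((a - b⁻¹) * littlewoodPf t (insert a (insert b Y))))) (𝓝[≠] b⁻¹)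
      (𝓝 (-(1 - t) / b * ((b⁻¹ - s) * (b - s)) *
        (∏ j ∈ X, pairKernel t b⁻¹ j * pairKernel t b j) *
        (levelCoeff t s w ((X.card - Y.card) / 2) * splitWeight t s X Y * littlewoodPf t Y))) := by
    intro Y hY
    rw [Finset.mem_powerset] at hY
    have hbY : b ∉ Y := fun h => hb (hY h)
    have hiY : b⁻¹ ∉ Y := fun h => hinvX (hY h)
    have hiXY : b⁻¹ ∉ X \ Y := fun h => hinvX (Finset.mem_sdiff.1 h).1
    have hsub : insert b Y ⊆ insert b X := Finset.insert_subset_insert b hY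
    have c1 := continuousAt_prod_crossWeight_left t hiXY
    have c2 := continuousAt_prod_crossWeight_right t hiY
    have c3 := continuousAt_littlewoodPf_insert t hiY fun c hc h =>
      hbY (by rw [inv_mul_eq_one₀ h0] at h; exact h ▸ hc)
    have c4 := continuousAt_crossWeight_left t hbb
    have c5 := continuousAt_crossWeight_right t hbb
    -- Unless a and b are both above level 0, no pair weight with denominator 1 - ab occurs and
    -- there is no pole at b⁻¹.
    have h1 : Tendsto (fun a => (a - b⁻¹) * (levelCoeff t s w ((X.card + 2 - Y.card) / 2) *
        ((∏ y ∈ Y, crossWeight t y a) * (∏ y ∈ Y, crossWeight t y b)) * littlewoodPf t Y +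
      levelCoeff t s w ((X.card + 1 - Y.card) / 2) *
        ((b - s) * (∏ i ∈ X \ Y, crossWeight t b i) * crossWeight t b a *
          (∏ y ∈ Y, crossWeight t y a) * littlewoodPf t (insert b Y) +
        (a - s) * (∏ i ∈ X \ Y, crossWeight t a i) * crossWeight t a b *
          (∏ y ∈ Y, crossWeight t y b) * littlewoodPf t (insert a Y)))) (𝓝[≠] b⁻¹) (𝓝 0) := by
      refine tendsto_punctured_of_continuousAt (ContinuousAt.mul (by fun_prop)
        (ContinuousAt.add (((c2.mul_const _).const_mul _).mul_const _)
          (ContinuousAt.const_mul (ContinuousAt.add ?_ ?_) _))) ?_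
      · exact (((c5.const_mul _)).mul c2).mul_const _
      · exact (((ContinuousAt.mul (by fun_prop) c1).mul c4).mul_const _).mul c3
      · ring
    have h3 : Tendsto (fun a => (a - b⁻¹) * littlewoodPf t (insert a (insert b Y))) (𝓝[≠] b⁻¹)
        (𝓝 (-(1 - t) / b * ((0 * b⁻¹ + 1) * (0 * b + 1)) *
          (∏ j ∈ Y, pairKernel t b⁻¹ j * pairKernel t b j) * littlewoodPf t Y)) :=
      tendsto_matchSum_reciprocal t 0 0 1 hbY (hX.mono hsub) h0
    have h4 : ContinuousAt (fun a => levelCoeff t s w ((X.card - Y.card) / 2) * ((a - s) * (b - s) *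
        ((∏ i ∈ X \ Y, crossWeight t a i) * (∏ i ∈ X \ Y, crossWeight t b i)))) b⁻¹ :=
      (ContinuousAt.mul (by fun_prop) (c1.mul_const _)).const_mul _
    have h5 := (h1.add (h4.tendsto_punctured.mul h3)).const_mul (splitWeight t s X Y)
    convert h5 using 2
    rw [← Finset.prod_sdiff hY, ← Finset.prod_mul_distrib,
      Finset.prod_congr rfl fun y (hy : y ∈ X \ Y) => pairKernel_inv_mul h0
        (ne_of_mem_of_not_mem (Finset.mem_sdiff.1 hy).1 hb).symm
        (ne_of_mem_of_not_mem (Finset.mem_sdiff.1 hy).1 hinvX).symm]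
    ring
  have h := tendsto_finsetSum X.powerset main
  rw [← Finset.mul_sum, ← levelSum] at h
  refine h.congr' ?_
  filter_upwards [eventually_punctured_notMem (V := insert b X)] with a ha
  rw [levelSum_insert_insert hb ha, Finset.mul_sum]
  exact Finset.sum_congr rfl fun Y _ => by ring

/-- The two sides of the finite identity differ by a constant in each variable. -/
theorem levelSum_sub_refinedPf_const (t s w : ℂ) (hV : Nonreciprocal V) (h0 : (0 : ℂ) ∉ V)
    (ih : ∀ b ∈ V, levelSum t s w (V.erase b) = refinedPf t s w (V.erase b)) :
    ∃ c, ∀ a ∉ poleSet V, levelSum t s w (insert a V) - refinedPf t s w (insert a V) = c := by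
  refine ((levelSum_properRat t s w hV h0).sub
    (matchSum_properRat t w 1 (-s) hV h0)).eq_const fun p hp => ?_
  rcases Finset.mem_union.1 hp with hp | hp
  · have hins := Finset.insert_erase hp
    have h1 := tendsto_levelSum_coincide t s w (Finset.notMem_erase p V) (by rwa [hins])
    have h2 := tendsto_matchSum_coincide t w 1 (-s) (Finset.notMem_erase p V) (by rwa [hins])
    rw [hins] at h1 h2
    simpa [mul_sub] using h1.sub h2
  -- Both residues at b⁻¹ are the same multiple of the respective side at `V.erase b`, where the two
  -- sides agree by `ih`.
  · obtain ⟨b, hb, rfl⟩ := Finset.mem_image.1 hp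
    have hb0 : b ≠ 0 := fun h => h0 (h ▸ hb)
    have hins := Finset.insert_erase hb
    have h1 := tendsto_levelSum_reciprocal t s w (Finset.notMem_erase b V) (by rwa [hins]) hb0
    have h2 := tendsto_matchSum_reciprocal t w 1 (-s) (Finset.notMem_erase b V) (by rwa [hins]) hb0
    have h3 := ih b hb
    rw [refinedPf] at h3
    rw [hins] at h1 h2
    rw [h3] at h1
    simpa [mul_sub, ← sub_eq_add_neg] using h1.sub h2

end

end

/-! ### The finite identity: exchange of variables and evaluation at a special configuration. -/

section
open Filter Topology

/-- A function of sets of fixed size that is unchanged when one element is replaced is constant. -/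
theorem eq_of_exchange {D : Finset ℂ → ℂ} {W : Finset ℂ} {N : ℕ}
    (h : ∀ V ⊆ W, V.card + 1 = N → ∀ a ∈ W, a ∉ V → ∀ b ∈ W, b ∉ V →
      D (insert a V) = D (insert b V)) {U U' : Finset ℂ} (hU : U ⊆ W) (hU' : U' ⊆ W)
    (hc : U.card = N) (hc' : U'.card = N) : D U = D U' := by
  induction hk : (U \ U').card generalizing U with
  | zero =>
    rw [Finset.card_eq_zero, Finset.sdiff_eq_empty_iff_subset] at hk
    rw [Finset.eq_of_subset_of_card_le hk (by omega)]
  | succ k ih =>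
    obtain ⟨a, ha⟩ : (U \ U').Nonempty := Finset.card_pos.1 (by omega)
    have hcomm : (U' \ U).card = (U \ U').card := Finset.card_sdiff_comm (by omega)
    obtain ⟨b, hb⟩ : (U' \ U).Nonempty := Finset.card_pos.1 (by omega)
    rw [Finset.mem_sdiff] at ha hb
    have hbe : b ∉ U.erase a := fun h => hb.2 (Finset.mem_of_mem_erase h)
    have hcard := Finset.card_erase_add_one ha.1
    have h1 := h (U.erase a) ((Finset.erase_subset _ _).trans hU) (by omega) a (hU ha.1)
      (Finset.notMem_erase _ _) b (hU' hb.1) hbe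
    rw [Finset.insert_erase ha.1] at h1
    rw [h1]
    refine ih (Finset.insert_subset (hU' hb.1) ((Finset.erase_subset _ _).trans hU)) ?_ ?_
    · rw [Finset.card_insert_of_notMem hbe]; omega
    · rw [Finset.insert_sdiff_of_mem _ hb.1, Finset.erase_sdiff_comm,
        Finset.card_erase_of_mem (Finset.mem_sdiff.2 ha), hk]
      rfl

theorem notMem_poleSet {V : Finset ℂ} {a : ℂ} (ha : a ∉ V) (h : ∀ b ∈ V, a * b ≠ 1)
    (h0 : (0 : ℂ) ∉ V) : a ∉ poleSet V := by
  intro hp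
  rcases Finset.mem_union.1 hp with hp | hp
  · exact ha hp
  · obtain ⟨b, hb, rfl⟩ := Finset.mem_image.1 hp
    exact h b hb (inv_mul_cancel₀ fun e => h0 (e ▸ hb))

theorem Nonreciprocal.insert {V : Finset ℂ} (hV : Nonreciprocal V) {a : ℂ} (ha : a ∉ poleSet V)
    (haa : a * a ≠ 1) : Nonreciprocal (insert a V) := by
  have key : ∀ b ∈ V, a * b ≠ 1 := fun b hb h =>
    ha ((eq_inv_of_mul_eq_one_left h) ▸ inv_mem_poleSet hb)
  intro x hx y hy
  rcases Finset.mem_insert.1 hx with rfl | hxV <;>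
    rcases Finset.mem_insert.1 hy with rfl | hyV
  · exact haa
  · exact key y hyV
  · rw [mul_comm]; exact key x hxV
  · exact hV x hxV y hyV

/-- The set `{s, s t, …, s t ^ (N - 1)}`. -/
noncomputable def geomSet (t s : ℂ) (N : ℕ) : Finset ℂ := (Finset.range N).image fun i => s * t ^ i

section
variable {t s w : ℂ}

theorem geom_injective (ht0 : t ≠ 0) (ht1 : ‖t‖ < 1) (hs : s ≠ 0) :
    Function.Injective fun i : ℕ => s * t ^ i := by
  intro i j h
  have h1 : t ^ i = t ^ j := mul_left_cancel₀ hs h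
  have h2 : ‖t‖ ^ i = ‖t‖ ^ j := by rw [← norm_pow, h1, norm_pow]
  exact pow_right_injective₀ (norm_pos_iff.2 ht0) ht1.ne h2

theorem card_geomSet (ht0 : t ≠ 0) (ht1 : ‖t‖ < 1) (hs : s ≠ 0) (N : ℕ) :
    (geomSet t s N).card = N := by
  rw [geomSet, Finset.card_image_of_injective _ (geom_injective ht0 ht1 hs), Finset.card_range]

/-- Take the least exponent occurring in Y. If it is 0, the factor j - s vanishes; otherwise the
preceding term of the progression lies outside Y and its cross weight with the least one vanishes.
-/
theorem splitWeight_geomSet {N : ℕ} {Y : Finset ℂ} (hY : Y ⊆ geomSet t s N) (hne : Y.Nonempty) :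
    splitWeight t s (geomSet t s N) Y = 0 := by
  classical
  have hex : ∃ i, s * t ^ i ∈ Y := by
    obtain ⟨y, hy⟩ := hne
    obtain ⟨i, _, rfl⟩ := Finset.mem_image.1 (hY hy)
    exact ⟨i, hy⟩
  have hmem := Nat.find_spec hex
  have hmin : ∀ i, i < Nat.find hex → s * t ^ i ∉ Y := fun i hi => Nat.find_min hex hi
  generalize Nat.find hex = i at hmem hmin
  cases i with
  | zero =>
    rw [splitWeight, Finset.prod_eq_zero hmem (by simp), zero_mul]
  | succ i =>
    have hY' := hmin i (Nat.lt_succ_self i)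
    rw [splitWeight]
    refine mul_eq_zero_of_right _ (Finset.prod_eq_zero hmem
      (Finset.prod_eq_zero (i := s * t ^ i) (Finset.mem_sdiff.2 ⟨?_, hY'⟩) ?_))
    -- The least exponent is taken among all naturals and powers could repeat. A representative
    -- below N of smaller exponent would contradict minimality, so s * t ^ i does belong to the
    -- progression.
    · by_cases hi : ∃ j ∈ Finset.range N, i ≤ j ∧ s * t ^ (i + 1) = s * t ^ j
      · obtain ⟨j, hj, hij, _⟩ := hi
        exact Finset.mem_image.2 ⟨i, Finset.mem_range.2
          (lt_of_le_of_lt hij (Finset.mem_range.1 hj)), rfl⟩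
      · obtain ⟨j, hj, hje⟩ := Finset.mem_image.1 (hY hmem)
        have hji : j < i := by
          by_contra hcon
          exact hi ⟨j, hj, not_lt.1 hcon, hje.symm⟩
        exact absurd (hje ▸ hmem) (hmin j (by omega))
    · rw [crossWeight, pow_succ]
      ring

theorem splitWeight_empty (U : Finset ℂ) : splitWeight t s U ∅ = 1 := by simp [splitWeight]

theorem littlewoodPf_empty : littlewoodPf t ∅ = 1 := matchSum_empty _ _

theorem levelSum_geomSet (ht0 : t ≠ 0) (ht1 : ‖t‖ < 1) (hs : s ≠ 0) (N : ℕ) :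
    levelSum t s w (geomSet t s N) = levelCoeff t s w (N / 2) := by
  rw [levelSum, Finset.sum_eq_single ∅]
  · simp [splitWeight_empty, littlewoodPf_empty, card_geomSet ht0 ht1 hs]
  · intro Y hY hne
    rw [splitWeight_geomSet (Finset.mem_powerset.1 hY) (Finset.nonempty_iff_ne_empty.2 hne)]
    ring
  · simp

/-- The product telescopes: the factor at st^i is (a - st^(i+1))/(a - st^i). -/
theorem linear_mul_prod_crossWeight (ht0 : t ≠ 0) (ht1 : ‖t‖ < 1) (hs : s ≠ 0) {N : ℕ} {a : ℂ}
    (ha : a ∉ geomSet t s N) :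
    (a - s) * ∏ i ∈ geomSet t s N, crossWeight t a i = a - s * t ^ N := by
  have h : ∀ i ∈ Finset.range N, a - s * t ^ i ≠ 0 := fun i hi =>
    sub_ne_zero.2 fun e => ha (Finset.mem_image.2 ⟨i, hi, e.symm⟩)
  rw [geomSet, Finset.prod_image (geom_injective ht0 ht1 hs).injOn]
  clear ha
  induction N with
  | zero => simp
  | succ N ih =>
    rw [Finset.prod_range_succ, ← mul_assoc, ih fun i hi => h i (by simp at hi ⊢; omega),
      crossWeight, mul_div_cancel₀ _ (h N (by simp))]
    ring

theorem matchSum_pair {K N : ℂ → ℂ → ℂ} (hK : ∀ a b, K a b = -K b a)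
    (hN : ∀ a b, N a b = N b a) {a b : ℂ} (hab : a ≠ b) : matchSum K N {a, b} = N a b := by
  rw [matchSum_expand_insert hK hN (by simpa using hab)]
  simp

theorem matchSum_singleton (K N : ℂ → ℂ → ℂ) (a : ℂ) : matchSum K N {a} = 0 :=
  matchSum_odd K N (by simp)

/-- The finite identity at a configuration where both sides can be evaluated. -/
theorem levelSum_eq_refinedPf_special (ht0 : t ≠ 0) (ht1 : ‖t‖ < 1) (hs : s ≠ 0) {m : ℕ} {a p : ℂ}
    (hap : t * a * p = 1) (ha : a ∉ insert p (geomSet t s (2 * m))) (hp : p ∉ geomSet t s (2 * m))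
    (ih : levelSum t s w (geomSet t s (2 * m)) = refinedPf t s w (geomSet t s (2 * m))) :
    levelSum t s w (insert a (insert p (geomSet t s (2 * m)))) =
      refinedPf t s w (insert a (insert p (geomSet t s (2 * m)))) := by
  have ht : t ≠ 1 := fun h => by simp [h] at ht1
  have ha0 : a ≠ 0 := by rintro rfl; simp at hap
  have hp' : p = (t * a)⁻¹ := eq_inv_of_mul_eq_one_right hap
  have haX : a ∉ geomSet t s (2 * m) := fun h => ha (Finset.mem_insert_of_mem h)
  have hne : a ≠ p := fun h => ha (h ▸ Finset.mem_insert_self _ _)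
  have h1t : 1 - a * p ≠ 0 := by
    intro h
    apply ht
    have : a * p = 1 := (sub_eq_zero.1 h).symm
    rw [mul_assoc, this, mul_one] at hap
    exact hap
  have hpair : (1 - t) / (1 - a * p) = -t := by
    rw [div_eq_iff h1t]
    linear_combination -hap
  have hR : refinedPf t s w (insert a (insert p (geomSet t s (2 * m)))) =
      (w - t * (a - s) * (p - s)) * t ^ (2 * m) * levelCoeff t s w m := by
    rw [refinedPf, matchSum_expand_insert (pairKernel_antisymm t) (pairWeight_comm t w 1 (-s)) ha,
      Finset.sum_insert hp, Finset.erase_insert hp]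
    -- Since tap = 1, the kernel between a and p vanishes, so only matchings containing the pair {a,
    -- p} survive.
    have hz : ∀ c ∈ geomSet t s (2 * m), pairWeight t w 1 (-s) a c *
        (∏ j ∈ (insert p (geomSet t s (2 * m))).erase c, pairKernel t a j * pairKernel t c j) *
          matchSum (pairKernel t) (pairWeight t w 1 (-s))
            ((insert p (geomSet t s (2 * m))).erase c) = 0 := by
      intro c hc
      have hpc : p ∈ (insert p (geomSet t s (2 * m))).erase c :=
        Finset.mem_erase.2 ⟨(ne_of_mem_of_not_mem hc hp).symm, Finset.mem_insert_self _ _⟩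
      rw [Finset.prod_eq_zero hpc (by rw [pairKernel, hap]; simp)]
      ring
    rw [Finset.sum_eq_zero hz, add_zero]
    have hprod : ∏ j ∈ geomSet t s (2 * m), pairKernel t a j * pairKernel t p j = t ^ (2 * m) := by
      rw [Finset.prod_congr rfl (g := fun _ => t), Finset.prod_const, card_geomSet ht0 ht1 hs]
      intro j hj
      have h1 : a - j ≠ 0 := sub_ne_zero.2 (ne_of_mem_of_not_mem hj haX).symm
      have h2 : p - j ≠ 0 := sub_ne_zero.2 (ne_of_mem_of_not_mem hj hp).symm
      rw [pairKernel, pairKernel, div_mul_div_comm, div_eq_iff (mul_ne_zero h1 h2)]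
      linear_combination (t * j ^ 2 - 1) * hap
    have hih := ih
    rw [levelSum_geomSet ht0 ht1 hs, Nat.mul_div_cancel_left m two_pos] at hih
    rw [hprod, ← refinedPf, ← hih, pairWeight]
    have : (1 - t) * (1 * a + -s) * (1 * p + -s) / (1 - a * p) =
        (1 - t) / (1 - a * p) * (a - s) * (p - s) := by ring
    rw [this, hpair]
    ring
  -- Only Y = ∅ contributes, and a single variable above level 0 gives an odd, hence zero, matching
  -- sum. So a and p are both on level 0 or both above it.
  have hL : levelSum t s w (insert a (insert p (geomSet t s (2 * m)))) =
      levelCoeff t s w (m + 1) -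
        t * (a - s * t ^ (2 * m)) * (p - s * t ^ (2 * m)) * levelCoeff t s w m := by
    rw [levelSum_insert_insert hp ha, Finset.sum_eq_single ∅]
    · rw [splitWeight_empty, card_geomSet ht0 ht1 hs, ← linear_mul_prod_crossWeight ht0 ht1 hs haX,
        ← linear_mul_prod_crossWeight ht0 ht1 hs hp]
      simp only [Finset.sdiff_empty, Finset.card_empty, Finset.prod_empty, insert_empty_eq]
      rw [littlewoodPf_empty, littlewoodPf, matchSum_singleton, littlewoodPf, matchSum_singleton,
        littlewoodPf, matchSum_pair (pairKernel_antisymm t) (pairWeight_comm t 0 0 1) hne,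
        pairWeight, show (2 * m + 2 - 0) / 2 = m + 1 by omega, show (2 * m - 0) / 2 = m by omega]
      simp only [zero_mul, zero_add, mul_one, hpair]
      ring
    · intro Y hY hne
      rw [splitWeight_geomSet (Finset.mem_powerset.1 hY) (Finset.nonempty_iff_ne_empty.2 hne)]
      ring
    · simp
  rw [hR, hL, levelCoeff, levelCoeff, Finset.prod_range_succ]
  -- With q = t^(2m), what is needed is t(a - sq)(p - sq) - qt(a - s)(p - s) = (1 - q)(1 - s²tq),
  -- true when tap = 1. This dictates the factors of `levelCoeff`.
  linear_combination (t ^ (2 * m) - 1) * (∏ x ∈ Finset.range m,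
    ((1 - t ^ (2 * x)) * (1 - s ^ 2 * t ^ (2 * x + 1)) + w * t ^ (2 * x))) * hap

/-- Holomorphy in s lets the identity, proved near s = 0, be continued to all s. -/
theorem differentiable_matchSum (K : ℂ → ℂ → ℂ) {N : ℂ → ℂ → ℂ → ℂ}
    (hN : ∀ a b, Differentiable ℂ fun s => N s a b) (U : Finset ℂ) :
    Differentiable ℂ fun s => matchSum K (N s) U := by
  have : ∀ m U, Differentiable ℂ fun s => matchSumAux K (N s) m U := by
    intro m
    induction m using Nat.strong_induction_on with
    | _ m ih =>
    intro U
    match m, ih with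
    | 0, _ => exact differentiable_const _
    | 1, _ => exact differentiable_const _
    | m + 2, ih =>
      simp only [matchSumAux]
      exact (Differentiable.fun_sum fun a _ => Differentiable.fun_sum fun b _ =>
        ((hN a b).mul_const _).mul (ih m (by omega) _)).const_mul _
  exact this _ U

theorem differentiable_refinedPf (t w : ℂ) (U : Finset ℂ) :
    Differentiable ℂ fun s => refinedPf t s w U :=
  differentiable_matchSum _ (fun a b => by unfold pairWeight; fun_prop) U

theorem differentiable_levelSum (t w : ℂ) (U : Finset ℂ) :
    Differentiable ℂ fun s => levelSum t s w U := by
  unfold levelSum levelCoeff splitWeight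
  fun_prop

theorem nonreciprocal_of_small {U : Finset ℂ} (hU : Nonreciprocal U) {δ : ℝ} (hδ1 : δ ≤ 1)
    (hδ : ∀ u ∈ U, δ * ‖u‖ < 1) {X : Finset ℂ} (hX : ∀ x ∈ X, ‖x‖ < δ) :
    Nonreciprocal (U ∪ X) := by
  have hlt : ∀ a b : ℂ, ‖a‖ * ‖b‖ < 1 → a * b ≠ 1 := by
    intro a b h e
    rw [← norm_mul, e, norm_one] at h
    exact lt_irrefl _ h
  have hUX : ∀ u ∈ U, ∀ x ∈ X, ‖x‖ * ‖u‖ < 1 := fun u hu x hx =>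
    (mul_le_mul_of_nonneg_right (hX x hx).le (norm_nonneg u)).trans_lt (hδ u hu)
  intro a ha b hb
  rcases Finset.mem_union.1 ha with ha | ha <;> rcases Finset.mem_union.1 hb with hb | hb
  · exact hU a ha b hb
  · exact hlt a b (mul_comm ‖a‖ _ ▸ hUX a ha b hb)
  · exact hlt a b (hUX b hb a ha)
  · refine hlt a b ?_
    have := hX a ha
    have := hX b hb
    nlinarith [norm_nonneg a, norm_nonneg b]

/-- The inductive step of the finite identity, for small `s` and nonzero variables. -/
theorem levelSum_eq_refinedPf_of_small (ht0 : t ≠ 0) (ht1 : ‖t‖ < 1) (hs : s ≠ 0) {m : ℕ}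
    (ih : ∀ V : Finset ℂ, Nonreciprocal V → V.card = 2 * m → levelSum t s w V = refinedPf t s w V)
    {U : Finset ℂ} (hU : Nonreciprocal U) (h0 : (0 : ℂ) ∉ U) (hc : U.card = 2 * m + 2) {δ : ℝ}
    (hδ1 : δ ≤ 1) (hδ : ∀ u ∈ U, δ * ‖u‖ < 1) (hsδ : ‖s‖ < δ) :
    levelSum t s w U = refinedPf t s w U := by
  set X := geomSet t s (2 * m) with hX
  have hXs : ∀ x ∈ X, x ≠ 0 ∧ ‖x‖ < δ := by
    intro x hx
    obtain ⟨i, _, rfl⟩ := Finset.mem_image.1 hx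
    refine ⟨mul_ne_zero hs (pow_ne_zero _ ht0), ?_⟩
    rw [norm_mul, norm_pow]
    exact (mul_le_of_le_one_right (norm_nonneg s)
      (pow_le_one₀ (norm_nonneg t) ht1.le)).trans_lt hsδ
  set W := U ∪ X with hW
  have hWn : Nonreciprocal W := nonreciprocal_of_small hU hδ1 hδ fun x hx => (hXs x hx).2
  have hW0 : (0 : ℂ) ∉ W := by
    rw [hW, Finset.mem_union, not_or]
    exact ⟨h0, fun h => (hXs 0 h).1 rfl⟩
  -- Since p will be 1/(ta), the equality a = p means a² = 1/t; avoiding ±c excludes it.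
  obtain ⟨c, hc2⟩ := IsAlgClosed.exists_pow_nat_eq (t⁻¹) (n := 2) two_pos
  set T := poleSet W ∪ {0, 1, -1} with hT
  -- The map x ↦ 1/(tx) is an involution on nonzero x, so avoiding the image of T keeps p outside T
  -- as well.
  obtain ⟨a, haT⟩ := Infinite.exists_notMem_finset
    (T ∪ T.image (fun x => (t * x)⁻¹) ∪ {c, -c})
  simp only [Finset.mem_union, not_or, Finset.mem_insert, Finset.mem_singleton] at haT
  obtain ⟨⟨haT, hpT⟩, hac, hac'⟩ := haT
  have not_mem : ∀ x, x ∉ T → x ∉ poleSet W ∧ x ≠ 0 ∧ x * x ≠ 1 := by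
    intro x hx
    simp only [hT, Finset.mem_union, Finset.mem_insert, Finset.mem_singleton, not_or] at hx
    refine ⟨hx.1, hx.2.1, fun h => ?_⟩
    rcases mul_self_eq_one_iff.1 h with h | h
    · exact hx.2.2.1 h
    · exact hx.2.2.2 h
  obtain ⟨ha1, ha0, haa⟩ := not_mem a haT
  set p := (t * a)⁻¹ with hp
  have hap : t * a * p = 1 := mul_inv_cancel₀ (mul_ne_zero ht0 ha0)
  obtain ⟨hp1, hp0, hpp⟩ := not_mem p fun h => hpT (Finset.mem_image.2 ⟨p, h, by
    rw [hp]; field_simp⟩)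
  have hne : a ≠ p := by
    intro h
    rw [← h] at hap
    have : a ^ 2 = c ^ 2 := by rw [hc2]; field_simp; linear_combination hap
    rcases sq_eq_sq_iff_eq_or_eq_neg.1 this with h | h
    · exact hac h
    · exact hac' h
  have ht : t ≠ 1 := fun h => by simp [h] at ht1
  have hpW : Nonreciprocal (insert p W) := hWn.insert hp1 hpp
  have hpW0 : (0 : ℂ) ∉ insert p W := by
    rw [Finset.mem_insert, not_or]; exact ⟨hp0.symm, hW0⟩
  have haW : a ∉ insert p W := by
    rw [Finset.mem_insert, not_or]
    exact ⟨hne, fun h => ha1 (subset_poleSet W h)⟩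
  have hapole : a ∉ poleSet (insert p W) := by
    refine notMem_poleSet haW (fun b hb => ?_) hpW0
    rcases Finset.mem_insert.1 hb with rfl | hb
    · intro h
      rw [mul_assoc, h, mul_one] at hap
      exact ht hap
    · exact fun h => ha1 (eq_inv_of_mul_eq_one_left h ▸ inv_mem_poleSet hb)
  have hgood : Nonreciprocal (insert a (insert p W)) := hpW.insert hapole haa
  have hgood0 : (0 : ℂ) ∉ insert a (insert p W) := by
    rw [Finset.mem_insert, not_or]; exact ⟨ha0.symm, hpW0⟩
  have hXW : X ⊆ W := Finset.subset_union_right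
  have haX : a ∉ insert p X := fun h => haW (Finset.insert_subset_insert p hXW h)
  have hpX : p ∉ X := fun h => hp1 (subset_poleSet W (hXW h))
  have hXc : X.card = 2 * m := card_geomSet ht0 ht1 hs _
  -- The difference of the two sides is carried from U to the special configuration by replacing one
  -- variable at a time; the whole pool of variables is nonreciprocal, so no pole is met.
  have hD := eq_of_exchange (D := fun U => levelSum t s w U - refinedPf t s w U)
    (W := insert a (insert p W)) (N := 2 * m + 2) (U := U) (U' := insert a (insert p X)) (by
      intro V hV hVc x hx hxV y hy hyV
      obtain ⟨d, hd⟩ := levelSum_sub_refinedPf_const t s w (hgood.mono hV) (fun h => hgood0 (hV h))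
        (by
          intro b hb
          refine ih _ (hgood.mono ((Finset.erase_subset _ _).trans hV)) ?_
          have := Finset.card_erase_add_one hb
          omega)
      have key : ∀ z ∈ insert a (insert p W), z ∉ V → z ∉ poleSet V := fun z hz hzV =>
        notMem_poleSet hzV (fun b hb => hgood z hz b (hV hb)) fun h => hgood0 (hV h)
      rw [hd x (key x hx hxV), hd y (key y hy hyV)])
    (Finset.subset_union_left.trans ((Finset.subset_insert _ _).trans (Finset.subset_insert _ _)))
    (Finset.insert_subset_insert _ (Finset.insert_subset_insert _ hXW)) hc
    (by rw [Finset.card_insert_of_notMem haX, Finset.card_insert_of_notMem hpX, hXc])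
  have hsp := levelSum_eq_refinedPf_special (w := w) ht0 ht1 hs hap haX hpX
    (ih X (hWn.mono hXW) hXc)
  rw [← hX] at hsp
  simp only [hsp, sub_self] at hD
  exact sub_eq_zero.1 hD

/-- The finite identity behind the refined Littlewood identity. -/
theorem levelSum_eq_refinedPf (ht0 : t ≠ 0) (ht1 : ‖t‖ < 1) (s w : ℂ) {m : ℕ} {U : Finset ℂ}
    (hU : Nonreciprocal U) (hc : U.card = 2 * m) : levelSum t s w U = refinedPf t s w U := by
  induction m generalizing U s with
  | zero =>
    rw [mul_zero, Finset.card_eq_zero] at hc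
    subst hc
    simp [levelSum, refinedPf, levelCoeff, splitWeight, littlewoodPf]
  | succ m ih =>
    have nonzero : ∀ U : Finset ℂ, Nonreciprocal U → (0 : ℂ) ∉ U → U.card = 2 * m + 2 →
        ∀ s, levelSum t s w U = refinedPf t s w U := by
      intro U hU h0 hc
      have hδ : ∃ δ : ℝ, 0 < δ ∧ δ ≤ 1 ∧ ∀ u ∈ U, δ * ‖u‖ < 1 := by
        have hS : 0 ≤ ∑ u ∈ U, ‖u‖ := Finset.sum_nonneg fun _ _ => norm_nonneg _
        refine ⟨(1 + ∑ u ∈ U, ‖u‖)⁻¹, by positivity, inv_le_one_of_one_le₀ (by linarith),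
          fun u hu => ?_⟩
        rw [inv_mul_lt_one₀ (by positivity)]
        have := Finset.single_le_sum (f := fun u : ℂ => ‖u‖) (fun _ _ => norm_nonneg _) hu
        linarith
      obtain ⟨δ, hδ0, hδ1, hδU⟩ := hδ
      have hev : ∀ᶠ s in 𝓝[≠] (0 : ℂ), levelSum t s w U = refinedPf t s w U := by
        have hball : ∀ᶠ s in 𝓝[≠] (0 : ℂ), s ∈ Metric.ball (0 : ℂ) δ :=
          nhdsWithin_le_nhds (Metric.ball_mem_nhds _ hδ0)
        filter_upwards [hball, self_mem_nhdsWithin] with s hs hs0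
        exact levelSum_eq_refinedPf_of_small ht0 ht1 hs0 (fun V hV hVc => ih s hV hVc)
          hU h0 hc hδ1 hδU (by simpa using hs)
      -- Both sides are entire in s and agree on a punctured neighbourhood of 0.
      exact fun s => congrFun (AnalyticOnNhd.eq_of_frequently_eq
        (fun z _ => (differentiable_levelSum t w U).analyticAt z)
        (fun z _ => (differentiable_refinedPf t w U).analyticAt z) hev.frequently) s
    by_cases h0 : (0 : ℂ) ∈ U
    · have hins := Finset.insert_erase h0
      set V := U.erase 0 with hV
      have hVU : V ⊆ U := Finset.erase_subset _ _
      have hVc : V.card + 1 = 2 * (m + 1) := by rw [Finset.card_erase_add_one h0, hc]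
      have hV0 : (0 : ℂ) ∉ V := Finset.notMem_erase _ _
      -- The variable 0 is traded for a generic nonzero a, the difference being constant in that
      -- variable.
      obtain ⟨d, hd⟩ := levelSum_sub_refinedPf_const t s w (hU.mono hVU) hV0 (by
        intro b hb
        refine ih s (hU.mono ((Finset.erase_subset _ _).trans hVU)) ?_
        have := Finset.card_erase_add_one hb
        omega)
      obtain ⟨a, ha⟩ := Infinite.exists_notMem_finset (poleSet V ∪ {0, 1, -1})
      simp only [Finset.mem_union, not_or, Finset.mem_insert, Finset.mem_singleton] at ha
      have haV : a ∉ V := fun h => ha.1 (subset_poleSet V h)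
      have h1 := hd 0 (notMem_poleSet hV0 (by simp) hV0)
      have h2 := hd a ha.1
      rw [nonzero (insert a V) ((hU.mono hVU).insert ha.1 fun h => by
          rcases mul_self_eq_one_iff.1 h with h | h
          · exact ha.2.2.1 h
          · exact ha.2.2.2 h)
        (by rw [Finset.mem_insert, not_or]; exact ⟨Ne.symm ha.2.1, hV0⟩)
        (by rw [Finset.card_insert_of_notMem haV]; omega) s, sub_self] at h2
      rw [hins, ← h2] at h1
      exact sub_eq_zero.1 h1
    · exact nonzero U hU h0 hc s

end

end

/-! ### Sums over permutations as recursions over sets of variables; the Pfaffian. -/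

section
variable {N : ℕ}

/-- The variables other than `u p`, in the order used by `Equiv.Perm.decomposeFin`. -/
def removeVar (u : Fin (N + 1) → ℂ) (p : Fin (N + 1)) (i : Fin N) : ℂ := u (Equiv.swap 0 p i.succ)

theorem removeVar_injective {u : Fin (N + 1) → ℂ} (hu : Function.Injective u) (p : Fin (N + 1)) :
    Function.Injective (removeVar u p) :=
  hu.comp ((Equiv.injective _).comp (Fin.succ_injective N))

theorem image_removeVar {u : Fin (N + 1) → ℂ} (hu : Function.Injective u) (p : Fin (N + 1)) :
    Finset.univ.image (removeVar u p) = (Finset.univ.image u).erase (u p) := by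
  ext x
  simp only [Finset.mem_image, Finset.mem_univ, true_and, Finset.mem_erase]
  constructor
  · rintro ⟨i, rfl⟩
    refine ⟨fun h => ?_, _, rfl⟩
    have h1 := hu h
    rw [Equiv.swap_apply_eq_iff, Equiv.swap_apply_right] at h1
    exact Fin.succ_ne_zero i h1
  · rintro ⟨hne, q, rfl⟩
    have hq : Equiv.swap 0 p q ≠ 0 := by
      intro h
      rw [Equiv.swap_apply_eq_iff, Equiv.swap_apply_left] at h
      exact hne (by rw [h])
    obtain ⟨i, hi⟩ := Fin.exists_succ_eq.2 hq
    exact ⟨i, by rw [removeVar, hi, Equiv.swap_apply_self]⟩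

/-- A sum over permutations of the variables, organised by the first variable. -/
theorem sum_perm_succ (u : Fin (N + 1) → ℂ) (G : (Fin (N + 1) → ℂ) → ℂ) :
    ∑ σ : Equiv.Perm (Fin (N + 1)), G (fun i => u (σ i)) =
      ∑ p, ∑ e : Equiv.Perm (Fin N),
        G (Fin.cons (α := fun _ => ℂ) (u p) fun i => removeVar u p (e i)) := by
  rw [← Equiv.sum_comp Equiv.Perm.decomposeFin.symm, Fintype.sum_prod_type]
  refine Finset.sum_congr rfl fun p _ => Finset.sum_congr rfl fun e _ => congrArg G ?_
  ext i
  refine Fin.cases ?_ (fun i => ?_) i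
  · rw [Equiv.Perm.decomposeFin_symm_apply_zero, Fin.cons_zero]
  · rw [Equiv.Perm.decomposeFin_symm_apply_succ, Fin.cons_succ, removeVar]

theorem sum_univ_eq_sum_image {u : Fin N → ℂ} (hu : Function.Injective u) (f : ℂ → ℂ) :
    ∑ p, f (u p) = ∑ a ∈ Finset.univ.image u, f a :=
  (Finset.sum_image hu.injOn).symm

theorem prod_univ_perm_eq_prod_image {u : Fin N → ℂ} (hu : Function.Injective u)
    (e : Equiv.Perm (Fin N)) (f : ℂ → ℂ) :
    ∏ i, f (u (e i)) = ∏ a ∈ Finset.univ.image u, f a := by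
  rw [Equiv.prod_comp e fun i => f (u i), Finset.prod_image hu.injOn]

theorem prod_Ioi_cons (f : ℂ → ℂ → ℂ) (a : ℂ) (v : Fin N → ℂ) :
    ∏ i : Fin (N + 1), ∏ j ∈ Finset.Ioi i, f (Fin.cons (α := fun _ => ℂ) a v i)
      (Fin.cons (α := fun _ => ℂ) a v j) =
      (∏ i, f a (v i)) * ∏ i, ∏ j ∈ Finset.Ioi i, f (v i) (v j) := by
  rw [Fin.prod_univ_succ, Fin.prod_Ioi_zero]
  simp only [Fin.cons_zero, Fin.cons_succ, Fin.prod_Ioi_succ]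

end

/-- The one-variable factor of the spin Hall–Littlewood function for a part of size `m`. -/
noncomputable def partFactor (t : ℂ) (s : ℕ → ℂ) (m : ℕ) (a : ℂ) : ℂ :=
  (1 - t) / (1 - s m * a) * ∏ j ∈ Finset.range m, (a - s j) / (1 - s j * a)

/-- The spin Hall–Littlewood function of a set of variables, by recursion on the list of parts. -/
noncomputable def shl (t : ℂ) (s : ℕ → ℂ) : List ℕ → Finset ℂ → ℂ
  | [], _ => 1
  | m :: l, U => ∑ a ∈ U,
      partFactor t s m a * (∏ b ∈ U.erase a, crossWeight t a b) * shl t s l (U.erase a)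

theorem sum_perm_eq_shl (t : ℂ) (s : ℕ → ℂ) {N : ℕ} (l : Fin N → ℕ) {u : Fin N → ℂ}
    (hu : Function.Injective u) :
    ∑ σ : Equiv.Perm (Fin N), (∏ i, ∏ j ∈ Finset.Ioi i, crossWeight t (u (σ i)) (u (σ j))) *
      ∏ i, partFactor t s (l i) (u (σ i)) = shl t s (List.ofFn l) (Finset.univ.image u) := by
  induction N with
  | zero => simp [shl]
  | succ N ih =>
    rw [sum_perm_succ u fun v => (∏ i, ∏ j ∈ Finset.Ioi i, crossWeight t (v i) (v j)) *
      ∏ i, partFactor t s (l i) (v i), List.ofFn_succ, shl, ← sum_univ_eq_sum_image hu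
      fun a => partFactor t s (l 0) a *
        (∏ b ∈ (Finset.univ.image u).erase a, crossWeight t a b) *
          shl t s (List.ofFn fun i => l i.succ) ((Finset.univ.image u).erase a)]
    refine Finset.sum_congr rfl fun p _ => ?_
    rw [← image_removeVar hu, ← ih (fun i => l i.succ) (removeVar_injective hu p), Finset.mul_sum]
    refine Finset.sum_congr rfl fun e _ => ?_
    rw [prod_Ioi_cons, Fin.prod_univ_succ (n := N),
      prod_univ_perm_eq_prod_image (removeVar_injective hu p)]
    simp only [Fin.cons_zero, Fin.cons_succ]
    ring

theorem spinHallLittlewood_eq_shl (t : ℂ) (s : ℕ → ℂ) {N : ℕ} (lam : Signature N) {u : Fin N → ℂ}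
    (hu : Function.Injective u) :
    spinHallLittlewood t s lam u = shl t s (List.ofFn lam.1) (Finset.univ.image u) :=
  sum_perm_eq_shl t s lam.1 hu

/-- The product of the entries over consecutive pairs of variables. -/
def consecutiveProd (M : ℂ → ℂ → ℂ) (n : ℕ) (v : Fin (2 * n) → ℂ) : ℂ :=
  ∏ i : Fin n, M (v ⟨2 * (i : ℕ), by omega⟩) (v ⟨2 * (i : ℕ) + 1, by omega⟩)

theorem consecutiveProd_succ (M : ℂ → ℂ → ℂ) (n : ℕ) (v : Fin (2 * n + 1 + 1) → ℂ) :
    consecutiveProd M (n + 1) v = M (v 0) (v 1) * consecutiveProd M n fun i => v i.succ.succ := by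
  rw [consecutiveProd, Fin.prod_univ_succ]
  rfl

/-- The first two values of the permutation form an ordered matched pair. The ratio 2(n + 1) of
successive constants 2^n n! is exactly the normalisation in `matchSum_average`. -/
theorem sum_perm_eq_matchSum_succ (K M N : ℂ → ℂ → ℂ) (n : ℕ) {u : Fin (2 * n + 1 + 1) → ℂ}
    (hu : Function.Injective u) (hN : ∀ i j, i ≠ j → K (u i) (u j) * M (u i) (u j) = N (u i) (u j))
    (ih : ∀ v : Fin (2 * n) → ℂ, Function.Injective v →
      (∀ i j, i ≠ j → K (v i) (v j) * M (v i) (v j) = N (v i) (v j)) →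
      ∑ σ : Equiv.Perm (Fin (2 * n)), (∏ i, ∏ j ∈ Finset.Ioi i, K (v (σ i)) (v (σ j))) *
        consecutiveProd M n (fun i => v (σ i)) =
          2 ^ n * (n ! : ℂ) * matchSum K N (Finset.univ.image v)) :
    ∑ σ : Equiv.Perm (Fin (2 * n + 1 + 1)), (∏ i, ∏ j ∈ Finset.Ioi i, K (u (σ i)) (u (σ j))) *
      consecutiveProd M (n + 1) (fun i => u (σ i)) =
        2 ^ (n + 1) * ((n + 1)! : ℂ) * matchSum K N (Finset.univ.image u) := by
  have hcard : (Finset.univ.image u).card = 2 * n + 1 + 1 := by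
    rw [Finset.card_image_of_injective _ hu, Finset.card_univ, Fintype.card_fin]
  have havg := matchSum_average K N (Finset.univ.image u) (Finset.card_pos.1 (by omega))
  rw [hcard] at havg
  refine (sum_perm_succ u fun v => (∏ i, ∏ j ∈ Finset.Ioi i, K (v i) (v j)) *
    consecutiveProd M (n + 1) v).trans ?_
  have hfac : (2 : ℂ) ^ (n + 1) * ((n + 1)! : ℂ) = 2 ^ n * (n ! : ℂ) * ((2 * n + 1 + 1 : ℕ) : ℂ) := by
    rw [Nat.factorial_succ]; push_cast; ring
  rw [hfac, mul_assoc (2 ^ n * (n ! : ℂ)), havg, ← sum_univ_eq_sum_image hu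
    (fun a => ∑ b ∈ (Finset.univ.image u).erase a, matchTerm K N (Finset.univ.image u) a b),
    Finset.mul_sum]
  refine Finset.sum_congr rfl fun p _ => ?_
  have hv := removeVar_injective hu p
  refine (sum_perm_succ (removeVar u p) fun v => (∏ i : Fin (2 * n + 1 + 1), ∏ j ∈ Finset.Ioi i,
    K (Fin.cons (α := fun _ => ℂ) (u p) v i) (Fin.cons (α := fun _ => ℂ) (u p) v j)) *
      consecutiveProd M (n + 1) (Fin.cons (α := fun _ => ℂ) (u p) v)).trans ?_
  rw [← image_removeVar hu, ← sum_univ_eq_sum_image hv fun b =>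
      matchTerm K N (Finset.univ.image u) (u p) b, Finset.mul_sum]
  refine Finset.sum_congr rfl fun q _ => ?_
  have hw := removeVar_injective hv q
  have hpq : K (u p) (removeVar u p q) * M (u p) (removeVar u p q) = N (u p) (removeVar u p q) := by
    refine hN p _ fun h => ?_
    rw [eq_comm, Equiv.swap_apply_eq_iff, Equiv.swap_apply_right] at h
    exact Fin.succ_ne_zero q h
  have hih := ih _ hw fun i j hij => hN _ _ fun h => hij (hw (congrArg u h))
  rw [matchTerm, ← image_removeVar hu, ← image_removeVar hv, ← hpq]
  rw [mul_left_comm, ← hih, Finset.mul_sum]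
  refine Finset.sum_congr rfl fun e _ => ?_
  rw [prod_Ioi_cons, prod_Ioi_cons, Fin.prod_univ_succ (n := 2 * n), consecutiveProd_succ,
    Finset.prod_mul_distrib, ← prod_univ_perm_eq_prod_image hw e,
    ← prod_univ_perm_eq_prod_image hw e]
  simp only [Fin.cons_zero, Fin.cons_succ, Fin.cons_one]
  ring

theorem sum_perm_eq_matchSum (K M N : ℂ → ℂ → ℂ) (n : ℕ) {u : Fin (2 * n) → ℂ}
    (hu : Function.Injective u) (hN : ∀ i j, i ≠ j → K (u i) (u j) * M (u i) (u j) = N (u i) (u j)) :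
    ∑ σ : Equiv.Perm (Fin (2 * n)), (∏ i, ∏ j ∈ Finset.Ioi i, K (u (σ i)) (u (σ j))) *
      consecutiveProd M n (fun i => u (σ i)) =
        2 ^ n * (n ! : ℂ) * matchSum K N (Finset.univ.image u) := by
  induction n with
  | zero => simp [consecutiveProd]
  | succ n ih => exact sum_perm_eq_matchSum_succ K M N n hu hN fun v hv hvN => ih hv hvN

/-- The Pfaffian times an antisymmetric product is a `matchSum`. -/
theorem prod_mul_pfaffian (K M N : ℂ → ℂ → ℂ) (hK : ∀ a b, K a b = -K b a) (n : ℕ)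
    {u : Fin (2 * n) → ℂ} (hu : Function.Injective u)
    (hN : ∀ i j, i ≠ j → K (u i) (u j) * M (u i) (u j) = N (u i) (u j)) :
    (∏ i, ∏ j ∈ Finset.Ioi i, K (u i) (u j)) * pfaffian (Matrix.of fun i j => M (u i) (u j)) =
      matchSum K N (Finset.univ.image u) := by
  have hne : (2 : ℂ) ^ n * (n ! : ℂ) ≠ 0 :=
    mul_ne_zero (pow_ne_zero _ two_ne_zero) (Nat.cast_ne_zero.2 n.factorial_ne_zero)
  apply mul_left_cancel₀ hne
  rw [← sum_perm_eq_matchSum K M N n hu hN, pfaffian, mul_left_comm, mul_inv_cancel_left₀ hne,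
    Finset.mul_sum]
  refine Finset.sum_congr rfl fun σ _ => ?_
  -- Permuting the variables multiplies the antisymmetric product by the sign of σ, which is the
  -- sign in the Pfaffian.
  have hs := σ.prod_Ioi_comp_eq_sign_mul_prod (f := fun i j => K (u i) (u j))
    fun i j => hK _ _
  rw [hs, consecutiveProd]
  simp only [Matrix.of_apply]
  ring

/-! ### The t-factorial from equal parts, and branching at level 0. -/

section
open Polynomial

/-- Let N = |U| and Q(z) = ∏(z - tb) - t^N ∏(z - b). As Q(0) = 0, Q(z)/z is a polynomial of degree
below N with coefficient 1 - t^N at z^(N-1). Lagrange interpolation at U computes this coefficient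
as the sum on the left. -/
theorem sum_prod_crossWeight_of_ne_zero (t : ℂ) {U : Finset ℂ} (h0 : (0 : ℂ) ∉ U) :
    (1 - t) * ∑ a ∈ U, ∏ b ∈ U.erase a, crossWeight t a b = 1 - t ^ U.card := by
  rcases U.eq_empty_or_nonempty with rfl | hne
  · simp
  have hpos : 0 < U.card := Finset.card_pos.2 hne
  set Q : ℂ[X] := ∏ b ∈ U, (X - C (t * b)) - C (t ^ U.card) * ∏ b ∈ U, (X - C b) with hQ
  have hm1 : (∏ b ∈ U, (X - C (t * b))).Monic := monic_prod_of_monic _ _ fun b _ => monic_X_sub_C _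
  have hm2 : (∏ b ∈ U, (X - C b)).Monic := monic_prod_of_monic _ _ fun b _ => monic_X_sub_C _
  have hd1 : (∏ b ∈ U, (X - C (t * b))).natDegree = U.card := by
    rw [natDegree_prod_of_monic _ _ fun b _ => monic_X_sub_C _]
    simp only [natDegree_X_sub_C, Finset.sum_const, smul_eq_mul, mul_one]
  have hd2 : (∏ b ∈ U, (X - C b)).natDegree = U.card := by
    rw [natDegree_prod_of_monic _ _ fun b _ => monic_X_sub_C _]; simp
  have hcoeff : Q.coeff U.card = 1 - t ^ U.card := by
    have h1 := hm1.coeff_natDegree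
    have h2 := hm2.coeff_natDegree
    rw [hd1] at h1
    rw [hd2] at h2
    rw [hQ, coeff_sub, coeff_C_mul, h1, h2, mul_one]
  have hQ0 : Q.coeff 0 = 0 := by
    rw [coeff_zero_eq_eval_zero, hQ]
    simp only [eval_sub, eval_prod, eval_mul, eval_X, eval_C, zero_sub, ← mul_neg]
    rw [Finset.prod_mul_distrib, Finset.prod_const, sub_self]
  have hQd : Q.natDegree ≤ U.card := by
    refine (natDegree_sub_le _ _).trans (max_le hd1.le ((natDegree_C_mul_le _ _).trans hd2.le))
  have hdeg : Q.divX.degree < U.card := by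
    rw [degree_lt_iff_coeff_zero]
    intro m hm
    rw [coeff_divX]
    exact coeff_eq_zero_of_natDegree_lt (by omega)
  have key := Lagrange.coeff_eq_sum (v := id) (s := U) Function.injective_id.injOn hdeg
  rw [coeff_divX, Nat.sub_add_cancel hpos, hcoeff] at key
  rw [key, Finset.mul_sum]
  refine Finset.sum_congr rfl fun a ha => ?_
  have ha0 : a ≠ 0 := fun h => h0 (h ▸ ha)
  have heval : Q.divX.eval a = (1 - t) * ∏ b ∈ U.erase a, (a - t * b) := by
    have h1 := congrArg (eval a) (divX_mul_X_add Q)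
    have h2 : eval a Q = (1 - t) * (∏ b ∈ U.erase a, (a - t * b)) * a := by
      rw [hQ]
      simp only [eval_sub, eval_prod, eval_mul, eval_X, eval_C]
      rw [Finset.prod_eq_zero (f := fun b => a - b) ha (sub_self a), mul_zero, sub_zero,
        ← Finset.mul_prod_erase U _ ha]
      ring
    rw [hQ0, C_0, add_zero, eval_mul, eval_X, h2] at h1
    exact mul_right_cancel₀ ha0 h1
  rw [id, heval, mul_div_assoc, ← Finset.prod_div_distrib]
  rfl

/-- The symmetrization identity behind the `t`-factorial. -/
theorem sum_prod_crossWeight (t : ℂ) (U : Finset ℂ) :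
    (1 - t) * ∑ a ∈ U, ∏ b ∈ U.erase a, crossWeight t a b = 1 - t ^ U.card := by
  -- The variable 0 decouples: its cross weight is 1 as second argument and t as first.
  by_cases h0 : (0 : ℂ) ∈ U
  · have h1 := sum_prod_crossWeight_of_ne_zero t (Finset.notMem_erase 0 U)
    rw [← Finset.add_sum_erase U _ h0]
    have h2 : ∏ b ∈ U.erase 0, crossWeight t 0 b = t ^ (U.erase 0).card := by
      rw [Finset.prod_congr rfl (g := fun _ => t), Finset.prod_const]
      intro b hb
      have : b ≠ 0 := Finset.ne_of_mem_erase hb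
      rw [crossWeight]
      field_simp
      ring
    have h3 : ∑ a ∈ U.erase 0, ∏ b ∈ U.erase a, crossWeight t a b =
        ∑ a ∈ U.erase 0, ∏ b ∈ (U.erase 0).erase a, crossWeight t a b := by
      refine Finset.sum_congr rfl fun a ha => ?_
      have ha0 : a ≠ 0 := Finset.ne_of_mem_erase ha
      rw [Finset.erase_right_comm, ← Finset.mul_prod_erase (U.erase a) _
        (Finset.mem_erase.2 ⟨ha0.symm, h0⟩)]
      rw [show crossWeight t a 0 = 1 by rw [crossWeight]; simp [ha0], one_mul]
    rw [h3, mul_add, h1, h2, ← Finset.card_erase_add_one h0]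
    ring
  · exact sum_prod_crossWeight_of_ne_zero t h0

end

theorem tPochhammer_succ (a t : ℂ) (k : ℕ) :
    tPochhammer a t (k + 1) = tPochhammer a t k * (1 - a * t ^ k) := Finset.prod_range_succ _ _

/-- The one-variable factors form a symmetric product, so only the cross weights are symmetrized,
producing one factor 1 - t^k at each size k. -/
theorem shl_replicate_zero (t : ℂ) (s : ℕ → ℂ) {m : ℕ} {U : Finset ℂ} (hU : U.card = m) :
    shl t s (List.replicate m 0) U = tPochhammer t t m * ∏ a ∈ U, (1 - s 0 * a)⁻¹ := by
  induction m generalizing U with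
  | zero =>
    rw [Finset.card_eq_zero] at hU
    simp [hU, shl, tPochhammer]
  | succ m ih =>
    rw [List.replicate_succ, shl, tPochhammer_succ, ← pow_succ', ← hU, ← sum_prod_crossWeight,
      Finset.mul_sum, Finset.mul_sum, Finset.sum_mul]
    refine Finset.sum_congr rfl fun a ha => ?_
    have hcard := Finset.card_erase_add_one ha
    rw [ih (by omega), ← Finset.mul_prod_erase U _ ha, partFactor, Finset.prod_range_zero]
    ring

/-- The parameters above level `0`. -/
def tailParam (s : ℕ → ℂ) (i : ℕ) : ℂ := s (i + 1)

theorem partFactor_succ (t : ℂ) (s : ℕ → ℂ) (m : ℕ) (a : ℂ) :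
    partFactor t s (m + 1) a = (a - s 0) / (1 - s 0 * a) * partFactor t (tailParam s) m a := by
  rw [partFactor, partFactor, Finset.prod_range_succ']
  simp only [tailParam]
  ring

/-- Branching of the spin Hall–Littlewood function according to the variables above level `0`. -/
theorem shl_map_succ_append (t : ℂ) (s : ℕ → ℂ) (l r : List ℕ) (U : Finset ℂ) :
    shl t s (l.map Nat.succ ++ r) U = ∑ J ∈ U.powersetCard l.length,
      (∏ a ∈ J, (a - s 0) / (1 - s 0 * a)) * shl t (tailParam s) l J *
        (∏ j ∈ J, ∏ i ∈ U \ J, crossWeight t j i) * shl t s r (U \ J) := by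
  induction l generalizing U with
  | nil => simp [shl]
  | cons m l ih =>
    rw [List.map_cons, List.cons_append, shl]
    have hL : ∀ a ∈ U, partFactor t s (Nat.succ m) a * (∏ b ∈ U.erase a, crossWeight t a b) *
        shl t s (l.map Nat.succ ++ r) (U.erase a) = ∑ J ∈ (U.erase a).powersetCard l.length,
          ((a - s 0) / (1 - s 0 * a) * (∏ x ∈ J, (x - s 0) / (1 - s 0 * x))) *
          (partFactor t (tailParam s) m a * (∏ b ∈ J, crossWeight t a b) *
            shl t (tailParam s) l J) *
          ((∏ i ∈ U.erase a \ J, crossWeight t a i) *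
            ∏ j ∈ J, ∏ i ∈ U.erase a \ J, crossWeight t j i) * shl t s r (U.erase a \ J) := by
      intro a _
      rw [ih, Finset.mul_sum]
      refine Finset.sum_congr rfl fun J hJ => ?_
      rw [Nat.succ_eq_add_one, partFactor_succ,
        ← Finset.prod_sdiff (Finset.mem_powersetCard.1 hJ).1]
      ring
    have hR : ∀ J ∈ U.powersetCard (m :: l).length,
        (∏ a ∈ J, (a - s 0) / (1 - s 0 * a)) * shl t (tailParam s) (m :: l) J *
          (∏ j ∈ J, ∏ i ∈ U \ J, crossWeight t j i) * shl t s r (U \ J) =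
        ∑ a ∈ J, ((a - s 0) / (1 - s 0 * a) * (∏ x ∈ J.erase a, (x - s 0) / (1 - s 0 * x))) *
          (partFactor t (tailParam s) m a * (∏ b ∈ J.erase a, crossWeight t a b) *
            shl t (tailParam s) l (J.erase a)) *
          ((∏ i ∈ U \ J, crossWeight t a i) *
            ∏ j ∈ J.erase a, ∏ i ∈ U \ J, crossWeight t j i) * shl t s r (U \ J) := by
      intro J _
      rw [shl, Finset.mul_sum, Finset.sum_mul, Finset.sum_mul]
      refine Finset.sum_congr rfl fun a ha => ?_
      rw [Finset.mul_prod_erase J (fun a => (a - s 0) / (1 - s 0 * a)) ha,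
        Finset.mul_prod_erase J (fun j => ∏ i ∈ U \ J, crossWeight t j i) ha]
    rw [Finset.sum_congr rfl hL, Finset.sum_congr rfl hR, Finset.sum_sigma', Finset.sum_sigma']
    -- The first chosen variable a together with the set J of the later ones corresponds to the set
    -- of all variables above level 0 with a marked element.
    refine Finset.sum_bij' (fun x _ => ⟨insert x.1 x.2, x.1⟩) (fun y _ => ⟨y.2, y.1.erase y.2⟩)
      ?_ ?_ ?_ ?_ ?_
    · rintro ⟨a, J⟩ h
      simp only [Finset.mem_sigma, Finset.mem_powersetCard, List.length_cons] at h ⊢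
      have haJ : a ∉ J := fun h' => Finset.notMem_erase a U (h.2.1 h')
      refine ⟨⟨Finset.insert_subset h.1 (h.2.1.trans (Finset.erase_subset _ _)), ?_⟩,
        Finset.mem_insert_self _ _⟩
      rw [Finset.card_insert_of_notMem haJ, h.2.2]
    · rintro ⟨J, a⟩ h
      simp only [Finset.mem_sigma, Finset.mem_powersetCard, List.length_cons] at h ⊢
      have := Finset.card_erase_add_one h.2
      exact ⟨h.1.1 h.2, Finset.erase_subset_erase _ h.1.1, by omega⟩
    · rintro ⟨a, J⟩ h
      simp only [Finset.mem_sigma, Finset.mem_powersetCard] at h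
      have haJ : a ∉ J := fun h' => Finset.notMem_erase a U (h.2.1 h')
      simp [Finset.erase_insert haJ]
    · rintro ⟨J, a⟩ h
      simp only [Finset.mem_sigma] at h
      simp [Finset.insert_erase h.2]
    · rintro ⟨a, J⟩ h
      simp only [Finset.mem_sigma, Finset.mem_powersetCard] at h
      have haJ : a ∉ J := fun h' => Finset.notMem_erase a U (h.2.1 h')
      have hs : U \ insert a J = U.erase a \ J := by
        ext x; simp only [Finset.mem_sdiff, Finset.mem_insert, Finset.mem_erase]; tauto
      simp only [Finset.erase_insert haJ, hs]

/-! ### Even signatures, classified by the number of nonzero parts. -/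

theorem card_filter_eq_count_ofFn {N : ℕ} (f : Fin N → ℕ) (i : ℕ) :
    (Finset.univ.filter fun k : Fin N => f k = i).card = (List.ofFn f).count i := by
  induction N with
  | zero => simp
  | succ N ih =>
    rw [List.ofFn_succ, List.count_cons, ← ih, Fin.card_filter_univ_succ]
    by_cases h : f 0 = i <;> simp [h]

theorem Signature.mult_eq_count {N : ℕ} (lam : Signature N) (i : ℕ) :
    lam.mult i = (List.ofFn lam.1).count i := card_filter_eq_count_ofFn _ _

/-- Raise all parts by one and append zeros. -/
def Signature.extend {k n : ℕ} (lam : Signature k) : Signature n :=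
  ⟨fun i => if h : (i : ℕ) < k then lam.1 ⟨i, h⟩ + 1 else 0, by
    intro i j hij
    have hij' : (i : ℕ) ≤ j := hij
    by_cases hj : (j : ℕ) < k
    · have hi : (i : ℕ) < k := by omega
      simp only [hj, hi, dif_pos]
      exact Nat.add_le_add_right (lam.2 (Fin.mk_le_mk.2 hij')) 1
    · simp [hj]⟩

theorem Signature.ofFn_extend {k n : ℕ} (h : k ≤ n) (lam : Signature k) :
    List.ofFn (lam.extend : Signature n).1 =
      (List.ofFn lam.1).map Nat.succ ++ List.replicate (n - k) 0 := by
  apply List.ext_getElem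
  · simp; omega
  · intro i h1 h2
    simp only [List.getElem_ofFn, Signature.extend, List.getElem_append, List.length_map,
      List.length_ofFn, List.getElem_map, List.getElem_replicate]

theorem Signature.mult_extend_zero {k n : ℕ} (h : k ≤ n) (lam : Signature k) :
    (lam.extend : Signature n).mult 0 = n - k := by
  rw [Signature.mult_eq_count, Signature.ofFn_extend h, List.count_append, List.count_replicate_self,
    List.count_eq_zero.2 (by simp), zero_add]

theorem Signature.mult_extend_succ {k n : ℕ} (h : k ≤ n) (lam : Signature k) (i : ℕ) :
    (lam.extend : Signature n).mult (i + 1) = lam.mult i := by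
  rw [Signature.mult_eq_count, Signature.ofFn_extend h, List.count_append,
    List.count_replicate, Signature.mult_eq_count]
  have h1 : List.count (i + 1) ((List.ofFn lam.1).map Nat.succ) = List.count i (List.ofFn lam.1) :=
    List.count_map_of_injective _ _ Nat.succ_injective i
  rw [h1]
  simp

/-- By monotonicity the zeros occupy exactly the last positions. -/
theorem Signature.pos_iff {N : ℕ} (lam : Signature N) (i : Fin N) :
    0 < lam.1 i ↔ (i : ℕ) < N - lam.mult 0 := by
  constructor
  · intro hi
    have hsub : (Finset.univ.filter fun k : Fin N => lam.1 k = 0) ⊆ Finset.Ioi i := by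
      intro j hj
      rw [Finset.mem_filter] at hj
      rw [Finset.mem_Ioi]
      by_contra hcon
      have := lam.2 (not_lt.1 hcon)
      omega
    have := Finset.card_le_card hsub
    rw [Fin.card_Ioi] at this
    change lam.mult 0 ≤ _ at this
    have := i.2
    omega
  · intro hi
    by_contra hcon
    have hsub : Finset.Ici i ⊆ (Finset.univ.filter fun k : Fin N => lam.1 k = 0) := by
      intro j hj
      rw [Finset.mem_Ici] at hj
      rw [Finset.mem_filter]
      have := lam.2 hj
      exact ⟨Finset.mem_univ _, by omega⟩
    have := Finset.card_le_card hsub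
    rw [Fin.card_Ici] at this
    change _ ≤ lam.mult 0 at this
    omega

theorem Signature.mult_le {N : ℕ} (lam : Signature N) (i : ℕ) : lam.mult i ≤ N :=
  (Finset.card_le_univ _).trans_eq (Fintype.card_fin N)

theorem Signature.extend_injective {k n : ℕ} (h : k ≤ n) :
    Function.Injective (Signature.extend : Signature k → Signature n) := by
  intro lam mu hlm
  ext i
  have h1 := congrFun (congrArg Subtype.val hlm) ⟨i, by omega⟩
  simpa [Signature.extend] using h1

/-- Even signatures of length `2 * n`, from the number `2 * k` of their nonzero parts. -/
def EvenSignature.extend (n : ℕ) (x : Σ k : Fin (n + 1), EvenSignature (2 * (k : ℕ))) :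
    EvenSignature (2 * n) :=
  ⟨x.2.1.extend, fun i => by
    have hk : 2 * (x.1 : ℕ) ≤ 2 * n := by have := x.1.2; omega
    cases i with
    | zero => rw [Signature.mult_extend_zero hk, ← Nat.mul_sub]; exact even_two_mul _
    | succ i => rw [Signature.mult_extend_succ hk]; exact x.2.2 i⟩

theorem EvenSignature.extend_bijective (n : ℕ) : Function.Bijective (EvenSignature.extend n) := by
  constructor
  · rintro ⟨k, lam⟩ ⟨l, mu⟩ h
    have hk : 2 * (k : ℕ) ≤ 2 * n := by have := k.2; omega
    have hl : 2 * (l : ℕ) ≤ 2 * n := by have := l.2; omega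
    have h1 : (lam.1.extend : Signature (2 * n)) = mu.1.extend := congrArg Subtype.val h
    have h2 : (lam.1.extend : Signature (2 * n)).mult 0 = (mu.1.extend : Signature (2 * n)).mult 0 :=
      congrArg (fun x => Signature.mult x 0) h1
    rw [Signature.mult_extend_zero hk, Signature.mult_extend_zero hl] at h2
    obtain rfl : k = l := Fin.ext (by omega)
    rw [Subtype.ext (Signature.extend_injective hk h1)]
  · intro lam
    obtain ⟨m, hm⟩ := lam.2 0
    have hle := lam.1.mult_le 0
    have hk : 2 * (n - m) ≤ 2 * n := by omega
    have hpos : ∀ i : Fin (2 * n), 0 < lam.1.1 i ↔ (i : ℕ) < 2 * (n - m) := by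
      intro i
      rw [Signature.pos_iff, hm]
      omega
    let mu : Signature (2 * (n - m)) := ⟨fun i => lam.1.1 ⟨i, by omega⟩ - 1, fun i j hij =>
      Nat.sub_le_sub_right (lam.1.2 (Fin.mk_le_mk.2 hij)) 1⟩
    have hmu : (mu.extend : Signature (2 * n)) = lam.1 := by
      ext i
      change (if h : (i : ℕ) < 2 * (n - m) then lam.1.1 ⟨i, _⟩ - 1 + 1 else 0) = lam.1.1 i
      have := hpos i
      split_ifs with h
      · have : 0 < lam.1.1 ⟨(i : ℕ), i.2⟩ := this.2 h
        simp only [Fin.eta] at this ⊢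
        omega
      · omega
    refine ⟨⟨⟨n - m, by omega⟩, ⟨mu, fun i => ?_⟩⟩, Subtype.ext hmu⟩
    rw [← Signature.mult_extend_succ hk, hmu]
    exact lam.2 (i + 1)

/-- A series over even signatures, summed according to the number of nonzero parts. -/
theorem hasSum_evenSignature {n : ℕ} {f : EvenSignature (2 * n) → ℂ} {v : Fin (n + 1) → ℂ}
    (h : ∀ k : Fin (n + 1), HasSum (fun lam : EvenSignature (2 * (k : ℕ)) =>
      f (EvenSignature.extend n ⟨k, lam⟩)) (v k)) : HasSum f (∑ k, v k) := by
  rw [← (Equiv.ofBijective _ (EvenSignature.extend_bijective n)).hasSum_iff]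
  have h1 : ∀ k ∈ Finset.univ, HasSum (fun x : Σ k : Fin (n + 1), EvenSignature (2 * (k : ℕ)) =>
      if x.1 = k then f (EvenSignature.extend n x) else 0) (v k) := by
    intro k _
    have hinj := @sigma_mk_injective _ (fun k : Fin (n + 1) => EvenSignature (2 * (k : ℕ))) k
    rw [← hinj.hasSum_iff]
    · simpa [Function.comp_def] using h k
    · rintro ⟨l, lam⟩ hx
      refine if_neg fun hlk => hx ?_
      simp only at hlk
      subst hlk
      exact ⟨lam, rfl⟩
  refine (hasSum_sum h1).congr_fun ?_
  intro x
  simp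

/-! ### Bounds uniform in the inhomogeneities, and absolute convergence. -/

section
open Filter Topology

/-- The weight of `m` parts of the same positive size, with `m` even. -/
noncomputable def partWeight (t s : ℂ) (m : ℕ) : ℂ :=
  ∏ j ∈ Finset.Icc 1 (m / 2), (1 - s ^ 2 * t ^ (2 * j - 2)) / (1 - t ^ (2 * j))

/-- The term of the Littlewood series. -/
noncomputable def evenTerm (t : ℂ) (s : ℕ → ℂ) {N : ℕ} (lam : EvenSignature N) (U : Finset ℂ) : ℂ :=
  (∏ᶠ i, partWeight t (s i) (lam.1.mult i)) * shl t s (List.ofFn lam.1.1) U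

/-- Admissibility of the inhomogeneities `s` for the variables `U`. -/
def Admissible (r : ℝ) (U : Finset ℂ) (s : ℕ → ℂ) : Prop :=
  ∀ a ∈ U, ∀ x, 1 - s x * a ≠ 0 ∧ ‖(a - s x) / (1 - s x * a)‖ ≤ r

section
variable {r : ℝ} {U V : Finset ℂ} {s : ℕ → ℂ} {t : ℂ}

theorem Admissible.tail (h : Admissible r U s) : Admissible r U (tailParam s) :=
  fun a ha x => h a ha (x + 1)

theorem Admissible.mono (h : Admissible r U s) (hV : V ⊆ U) : Admissible r V s :=
  fun a ha x => h a (hV ha) x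

theorem Admissible.norm_le (h : Admissible r U s) {a : ℂ} (ha : a ∈ U) (x : ℕ) :
    ‖a - s x‖ ≤ r * ‖1 - s x * a‖ := by
  have h1 := (h a ha x).2
  rwa [norm_div, div_le_iff₀ (norm_pos_iff.2 (h a ha x).1)] at h1

/-- If ab = 1, then a - s_0 = a(1 - s_0 b) and b - s_0 = b(1 - s_0 a), so the two ratios would have
product of norm 1, against the bound r² < 1. -/
theorem Admissible.nonreciprocal (h : Admissible r U s) (hr0 : 0 ≤ r) (hr1 : r < 1) :
    Nonreciprocal U := by
  intro a ha b hb hab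
  have e1 : a - s 0 = a * (1 - s 0 * b) := by linear_combination s 0 * hab
  have e2 : b - s 0 = b * (1 - s 0 * a) := by linear_combination s 0 * hab
  have h1 := h.norm_le ha 0
  have h2 := h.norm_le hb 0
  have p1 := norm_pos_iff.2 (h a ha 0).1
  have p2 := norm_pos_iff.2 (h b hb 0).1
  have hn : ‖a‖ * ‖b‖ = 1 := by rw [← norm_mul, hab, norm_one]
  rw [e1, norm_mul] at h1
  rw [e2, norm_mul] at h2
  have h3 := mul_le_mul h1 h2 (by positivity) (by positivity)
  have h4 : ‖a‖ * ‖1 - s 0 * b‖ * (‖b‖ * ‖1 - s 0 * a‖) = ‖1 - s 0 * a‖ * ‖1 - s 0 * b‖ := by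
    linear_combination ‖1 - s 0 * b‖ * ‖1 - s 0 * a‖ * hn
  have h5 : r * r < 1 := by nlinarith
  have h6 := mul_pos p1 p2
  nlinarith

/-- The s_x are not assumed bounded. The identities 1 - a² = (1 - s_x a) - a(a - s_x) and s_x(1 -
a²) = a(1 - s_x a) - (a - s_x) show that 1 - s_x a is at least of the order of 1 + |s_x|. -/
theorem Admissible.one_add_norm_le (h : Admissible r U s) (hr0 : 0 ≤ r) (hr1 : r < 1) {a : ℂ}
    (ha : a ∈ U) (x : ℕ) :
    ‖(1 - s x * a)⁻¹‖ * (1 + ‖s x‖) ≤ 2 * (1 + ‖a‖) / ‖1 - a * a‖ := by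
  have haa : 1 - a * a ≠ 0 := sub_ne_zero.2 (h.nonreciprocal hr0 hr1 a ha a ha).symm
  have h1 := h.norm_le ha x
  have p1 := norm_pos_iff.2 (h a ha x).1
  have p2 := norm_pos_iff.2 haa
  have h2 : ‖1 - a * a‖ ≤ ‖1 - s x * a‖ + ‖a‖ * ‖a - s x‖ := by
    rw [← norm_mul]
    refine le_trans (le_of_eq ?_) (norm_sub_le _ _)
    congr 1; ring
  have h3 : ‖s x‖ * ‖1 - a * a‖ ≤ ‖a‖ * ‖1 - s x * a‖ + ‖a - s x‖ := by
    rw [← norm_mul, ← norm_mul]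
    refine le_trans (le_of_eq ?_) (norm_sub_le _ _)
    congr 1; ring
  have h4 : ‖a - s x‖ ≤ ‖1 - s x * a‖ := h1.trans (mul_le_of_le_one_left p1.le hr1.le)
  have h5 : ‖a‖ * ‖a - s x‖ ≤ ‖a‖ * ‖1 - s x * a‖ := mul_le_mul_of_nonneg_left h4 (norm_nonneg a)
  rw [norm_inv, inv_mul_eq_div, div_le_div_iff₀ p1 p2]
  linarith

theorem norm_partFactor_le (h : Admissible r U s) (hr0 : 0 ≤ r) (hr1 : r < 1) {a : ℂ}
    (ha : a ∈ U) (m : ℕ) :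
    ‖partFactor t s m a‖ * (1 + ‖s m‖) ≤ ‖1 - t‖ * (2 * (1 + ‖a‖) / ‖1 - a * a‖) * r ^ m := by
  have h1 := h.one_add_norm_le hr0 hr1 ha m
  have h2 : ‖∏ j ∈ Finset.range m, (a - s j) / (1 - s j * a)‖ ≤ r ^ m := by
    rw [norm_prod]
    refine (Finset.prod_le_prod (fun _ _ => norm_nonneg _) fun j _ => (h a ha j).2).trans ?_
    simp
  rw [partFactor, norm_mul, div_eq_mul_inv, norm_mul]
  calc ‖1 - t‖ * ‖(1 - s m * a)⁻¹‖ * ‖∏ j ∈ Finset.range m, (a - s j) / (1 - s j * a)‖ * (1 + ‖s m‖)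
      = ‖1 - t‖ * (‖(1 - s m * a)⁻¹‖ * (1 + ‖s m‖)) *
        ‖∏ j ∈ Finset.range m, (a - s j) / (1 - s j * a)‖ := by ring
    _ ≤ _ := by gcongr

/-- Geometric decay of the spin Hall–Littlewood functions, uniformly in the inhomogeneities. -/
theorem exists_norm_shl_le (t : ℂ) (hr0 : 0 ≤ r) (hr1 : r < 1) (U : Finset ℂ) {c : ℝ} (hc : 0 ≤ c) :
    ∃ M : ℝ, 0 ≤ M ∧ ∀ s, Admissible r U s → ∀ (l : List ℕ), ∀ V ⊆ U,
      ‖shl t s l V‖ * (l.map fun m => c * (1 + ‖s m‖)).prod ≤ M ^ l.length * r ^ l.sum := by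
  set Q : ℝ := ∑ V ∈ U.powerset, ∑ a ∈ U, ‖∏ b ∈ V.erase a, crossWeight t a b‖ with hQ
  set B : ℝ := ∑ a ∈ U, ‖1 - t‖ * (2 * (1 + ‖a‖) / ‖1 - a * a‖) with hB
  have hQ0 : 0 ≤ Q := Finset.sum_nonneg fun _ _ => Finset.sum_nonneg fun _ _ => norm_nonneg _
  have hB0 : 0 ≤ B := Finset.sum_nonneg fun _ _ => by positivity
  have hQle : ∀ V ⊆ U, ∀ a ∈ U, ‖∏ b ∈ V.erase a, crossWeight t a b‖ ≤ Q := by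
    intro V hV a ha
    refine le_trans ?_ (Finset.single_le_sum (f := fun V : Finset ℂ =>
      ∑ a ∈ U, ‖∏ b ∈ V.erase a, crossWeight t a b‖)
      (fun _ _ => Finset.sum_nonneg fun _ _ => norm_nonneg _) (Finset.mem_powerset.2 hV))
    exact Finset.single_le_sum (f := fun a => ‖∏ b ∈ V.erase a, crossWeight t a b‖)
      (fun _ _ => norm_nonneg _) ha
  have hBle : ∀ a ∈ U, ‖1 - t‖ * (2 * (1 + ‖a‖) / ‖1 - a * a‖) ≤ B := fun a ha =>
    Finset.single_le_sum (f := fun a : ℂ => ‖1 - t‖ * (2 * (1 + ‖a‖) / ‖1 - a * a‖))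
      (fun _ _ => by positivity) ha
  -- Each part costs a choice among at most |U| variables, a one-variable factor bounded by B r^m
  -- once 1 + |s_m| is included, the constant c, and cross weights bounded by Q.
  refine ⟨U.card * (B * c * Q), by positivity, fun s hs l => ?_⟩
  induction l with
  | nil => intro V _; simp [shl]
  | cons m l ih =>
    intro V hV
    rw [shl, List.map_cons, List.prod_cons, List.length_cons, List.sum_cons]
    set P := (l.map fun m => c * (1 + ‖s m‖)).prod with hP
    have hP0 : 0 ≤ P := by
      refine List.prod_nonneg fun x hx => ?_
      obtain ⟨m, _, rfl⟩ := List.mem_map.1 hx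
      positivity
    have hstep : ∀ a ∈ V, ‖partFactor t s m a * (∏ b ∈ V.erase a, crossWeight t a b) *
        shl t s l (V.erase a)‖ * (c * (1 + ‖s m‖) * P) ≤
        B * c * Q * r ^ m * ((U.card * (B * c * Q)) ^ l.length * r ^ l.sum) := by
      intro a ha
      have h1 : ‖partFactor t s m a‖ * (1 + ‖s m‖) ≤ B * r ^ m :=
        (norm_partFactor_le hs hr0 hr1 (hV ha) m).trans
          (mul_le_mul_of_nonneg_right (hBle a (hV ha)) (by positivity))
      have h2 := hQle V hV a (hV ha)
      have h3 := ih (V.erase a) ((Finset.erase_subset _ _).trans hV)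
      rw [norm_mul, norm_mul]
      calc ‖partFactor t s m a‖ * ‖∏ b ∈ V.erase a, crossWeight t a b‖ * ‖shl t s l (V.erase a)‖ *
            (c * (1 + ‖s m‖) * P) = (‖partFactor t s m a‖ * (1 + ‖s m‖)) * c *
            ‖∏ b ∈ V.erase a, crossWeight t a b‖ * (‖shl t s l (V.erase a)‖ * P) := by ring
        _ ≤ (B * r ^ m) * c * Q * ((U.card * (B * c * Q)) ^ l.length * r ^ l.sum) := by gcongr
        _ = _ := by ring
    calc _ ≤ (∑ a ∈ V, ‖partFactor t s m a * (∏ b ∈ V.erase a, crossWeight t a b) *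
        shl t s l (V.erase a)‖) * (c * (1 + ‖s m‖) * P) := by
          gcongr
          exact norm_sum_le _ _
      _ ≤ ∑ a ∈ V, B * c * Q * r ^ m * ((U.card * (B * c * Q)) ^ l.length * r ^ l.sum) := by
          rw [Finset.sum_mul]
          exact Finset.sum_le_sum hstep
      _ = V.card * (B * c * Q * r ^ m * ((U.card * (B * c * Q)) ^ l.length * r ^ l.sum)) := by
          rw [Finset.sum_const, nsmul_eq_mul]
      _ ≤ U.card * (B * c * Q * r ^ m * ((U.card * (B * c * Q)) ^ l.length * r ^ l.sum)) := by
          gcongr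
      _ = _ := by ring

theorem Signature.mult_eq_zero {N : ℕ} (lam : Signature N) {i : ℕ}
    (hi : i ∉ Finset.univ.image lam.1) : lam.mult i = 0 := by
  rw [Signature.mult, Finset.card_eq_zero, Finset.filter_eq_empty_iff]
  intro k _ hk
  exact hi (Finset.mem_image.2 ⟨k, Finset.mem_univ _, hk⟩)

theorem partWeight_zero (t s : ℂ) : partWeight t s 0 = 1 := by simp [partWeight]

theorem finprod_partWeight_eq {N : ℕ} (lam : Signature N) (t : ℂ) (s : ℕ → ℂ) :
    ∏ᶠ i, partWeight t (s i) (lam.mult i) =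
      ∏ i ∈ Finset.univ.image lam.1, partWeight t (s i) (lam.mult i) := by
  refine finprod_eq_prod_of_mulSupport_subset _ fun i hi => ?_
  by_contra hcon
  exact hi (by beta_reduce; rw [lam.mult_eq_zero (by simpa using hcon), partWeight_zero])

/-- Each of the m/2 factors is at most the square of (1 + |s|)/(1 - |t|), that is, one such factor
per part. This growth in s is what the weight in `exists_norm_shl_le` absorbs. -/
theorem norm_partWeight_le (ht1 : ‖t‖ < 1) (s : ℂ) {m : ℕ} (hm : Even m) :
    ‖partWeight t s m‖ ≤ ((1 - ‖t‖)⁻¹ * (1 + ‖s‖)) ^ m := by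
  obtain ⟨p, rfl⟩ := hm
  have h0 : 0 < 1 - ‖t‖ := by linarith
  have h1 : 1 ≤ (1 - ‖t‖)⁻¹ := (one_le_inv₀ h0).2 (by linarith [norm_nonneg t])
  rw [partWeight, norm_prod, show (p + p) / 2 = p by omega, ← two_mul, pow_mul]
  have : ∀ j ∈ Finset.Icc 1 p, ‖(1 - s ^ 2 * t ^ (2 * j - 2)) / (1 - t ^ (2 * j))‖ ≤
      ((1 - ‖t‖)⁻¹ * (1 + ‖s‖)) ^ 2 := by
    intro j hj
    rw [Finset.mem_Icc] at hj
    have hnum : ‖1 - s ^ 2 * t ^ (2 * j - 2)‖ ≤ (1 + ‖s‖) ^ 2 := by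
      refine (norm_sub_le _ _).trans ?_
      rw [norm_one, norm_mul, norm_pow, norm_pow]
      have := mul_le_of_le_one_right (sq_nonneg ‖s‖)
        (pow_le_one₀ (n := 2 * j - 2) (norm_nonneg t) ht1.le)
      nlinarith [norm_nonneg s]
    have hden : 1 - ‖t‖ ≤ ‖1 - t ^ (2 * j)‖ := by
      have h2 := norm_sub_norm_le 1 (t ^ (2 * j))
      rw [norm_one, norm_pow] at h2
      have h3 : ‖t‖ ^ (2 * j) ≤ ‖t‖ := pow_le_of_le_one (norm_nonneg t) ht1.le (by omega)
      linarith
    rw [norm_div, mul_pow, div_eq_inv_mul]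
    refine mul_le_mul ?_ hnum (norm_nonneg _) (by positivity)
    calc ‖1 - t ^ (2 * j)‖⁻¹ ≤ (1 - ‖t‖)⁻¹ := inv_anti₀ h0 hden
      _ ≤ (1 - ‖t‖)⁻¹ ^ 2 := le_self_pow₀ h1 two_ne_zero
  refine (Finset.prod_le_prod (fun _ _ => norm_nonneg _) this).trans ?_
  simp

theorem norm_finprod_partWeight_le (ht1 : ‖t‖ < 1) (s : ℕ → ℂ) {N : ℕ} (lam : EvenSignature N) :
    ‖∏ᶠ i, partWeight t (s i) (lam.1.mult i)‖ ≤
      ((List.ofFn lam.1.1).map fun m => (1 - ‖t‖)⁻¹ * (1 + ‖s m‖)).prod := by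
  rw [finprod_partWeight_eq, norm_prod, List.map_ofFn, List.prod_ofFn]
  simp only [Function.comp_apply]
  rw [Finset.prod_comp (fun m => (1 - ‖t‖)⁻¹ * (1 + ‖s m‖)) lam.1.1]
  exact Finset.prod_le_prod (fun _ _ => norm_nonneg _) fun i _ => norm_partWeight_le ht1 _ (lam.2 i)

theorem summable_pow_sum (hr0 : 0 ≤ r) (hr1 : r < 1) (N : ℕ) :
    Summable fun f : Fin N → ℕ => r ^ (List.ofFn f).sum := by
  induction N with
  | zero => exact Summable.of_finite
  | succ N ih =>
    rw [← (Fin.consEquiv fun _ : Fin (N + 1) => ℕ).summable_iff]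
    have h := (summable_geometric_of_lt_one hr0 hr1).mul_of_nonneg ih
      (fun _ => pow_nonneg hr0 _) (fun _ => pow_nonneg hr0 _)
    refine h.congr fun x => ?_
    simp [Fin.consEquiv, List.ofFn_succ, pow_add]

theorem summable_evenSignature_pow (hr0 : 0 ≤ r) (hr1 : r < 1) (N : ℕ) :
    Summable fun lam : EvenSignature N => r ^ (List.ofFn lam.1.1).sum :=
  (summable_pow_sum hr0 hr1 N).comp_injective
    (Subtype.val_injective.comp Subtype.val_injective : Function.Injective
      fun lam : EvenSignature N => lam.1.1)

theorem exists_norm_evenTerm_le (ht1 : ‖t‖ < 1) (hr0 : 0 ≤ r) (hr1 : r < 1) (U : Finset ℂ) :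
    ∃ M : ℝ, 0 ≤ M ∧ ∀ s, Admissible r U s → ∀ (N : ℕ) (lam : EvenSignature N),
      ‖evenTerm t s lam U‖ ≤ M ^ N * r ^ (List.ofFn lam.1.1).sum := by
  have h0 : 0 ≤ (1 - ‖t‖)⁻¹ := inv_nonneg.2 (by linarith)
  obtain ⟨M, hM, h⟩ := exists_norm_shl_le t hr0 hr1 U h0
  refine ⟨M, hM, fun s hs N lam => ?_⟩
  have h1 := h s hs (List.ofFn lam.1.1) U subset_rfl
  rw [List.length_ofFn] at h1
  rw [evenTerm, norm_mul, mul_comm]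
  exact (mul_le_mul_of_nonneg_left (norm_finprod_partWeight_le ht1 s lam) (norm_nonneg _)).trans h1

theorem summable_evenTerm (ht1 : ‖t‖ < 1) (hr0 : 0 ≤ r) (hr1 : r < 1) (hs : Admissible r U s)
    (N : ℕ) : Summable fun lam : EvenSignature N => evenTerm t s lam U := by
  obtain ⟨M, _, h⟩ := exists_norm_evenTerm_le ht1 hr0 hr1 U
  exact Summable.of_norm_bounded ((summable_evenSignature_pow hr0 hr1 N).mul_left (M ^ N))
    (h s hs N)

theorem exists_norm_tsum_evenTerm_le (ht1 : ‖t‖ < 1) (hr0 : 0 ≤ r) (hr1 : r < 1) (U : Finset ℂ)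
    (N : ℕ) : ∃ B : ℝ, ∀ s, Admissible r U s →
      ‖∑' lam : EvenSignature N, evenTerm t s lam U‖ ≤ B := by
  obtain ⟨M, _, h⟩ := exists_norm_evenTerm_le ht1 hr0 hr1 U
  exact ⟨_, fun s hs => tsum_of_norm_bounded
    ((summable_evenSignature_pow hr0 hr1 N).mul_left (M ^ N)).hasSum (h s hs N)⟩

theorem finprod_partWeight_eq_mul {N : ℕ} (lam : Signature N) (t : ℂ) (s : ℕ → ℂ) :
    ∏ᶠ i, partWeight t (s i) (lam.mult i) = partWeight t (s 0) (lam.mult 0) *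
      ∏ᶠ i, partWeight t (s (i + 1)) (lam.mult (i + 1)) := by
  obtain ⟨B, hB⟩ : ∃ B, ∀ i, B ≤ i → lam.mult i = 0 := by
    obtain ⟨B, hB⟩ := (Finset.univ.image lam.1).exists_nat_subset_range
    exact ⟨B, fun i hi => lam.mult_eq_zero fun h => by have := Finset.mem_range.1 (hB h); omega⟩
  rw [finprod_eq_prod_of_mulSupport_subset (s := Finset.range (B + 1)),
    finprod_eq_prod_of_mulSupport_subset (s := Finset.range B), Finset.prod_range_succ', mul_comm]
  · intro i hi
    by_contra hcon
    exact hi (by beta_reduce; rw [hB _ (by simp at hcon; omega), partWeight_zero])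
  · intro i hi
    by_contra hcon
    exact hi (by beta_reduce; rw [hB _ (by simp at hcon; omega), partWeight_zero])

/-! ### The Littlewood identity by iterated branching, and its refinement. -/

/-- The Littlewood series. -/
noncomputable def littlewoodSum (t : ℂ) (s : ℕ → ℂ) (k : ℕ) (U : Finset ℂ) : ℂ :=
  ∑' lam : EvenSignature (2 * k), evenTerm t s lam U

/-- Branching of the Littlewood series, with an arbitrary weight for the parts equal to `0`. -/
theorem hasSum_branching (ht1 : ‖t‖ < 1) (hr0 : 0 ≤ r) (hr1 : r < 1) (hs : Admissible r U s)
    {n : ℕ} (hU : U.card = 2 * n) (d : ℕ → ℂ) :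
    HasSum (fun lam : EvenSignature (2 * n) => d (lam.1.mult 0) * (∏ a ∈ U, (1 - s 0 * a)) *
        (∏ᶠ i, partWeight t (s (i + 1)) (lam.1.mult (i + 1))) * shl t s (List.ofFn lam.1.1) U)
      (∑ k : Fin (n + 1), ∑ J ∈ U.powersetCard (2 * (k : ℕ)), d (2 * (n - k)) *
        tPochhammer t t (2 * (n - k)) * splitWeight t (s 0) U J *
          littlewoodSum t (tailParam s) k J) := by
  refine hasSum_evenSignature fun k => ?_
  have hk : 2 * (k : ℕ) ≤ 2 * n := by have := k.2; omega
  have h1 : ∀ J ∈ U.powersetCard (2 * (k : ℕ)), HasSum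
      (fun lam : EvenSignature (2 * (k : ℕ)) => d (2 * (n - k)) *
        tPochhammer t t (2 * (n - k)) * splitWeight t (s 0) U J * evenTerm t (tailParam s) lam J)
      (d (2 * (n - k)) * tPochhammer t t (2 * (n - k)) * splitWeight t (s 0) U J *
          littlewoodSum t (tailParam s) k J) := fun J hJ =>
    (summable_evenTerm ht1 hr0 hr1 (hs.tail.mono (Finset.mem_powersetCard.1 hJ).1) _).hasSum.mul_left
      _
  convert hasSum_sum h1 using 2 with lam
  have e1 : (EvenSignature.extend n ⟨k, lam⟩).1 = lam.1.extend := rfl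
  rw [e1, Signature.mult_extend_zero hk, Signature.ofFn_extend hk, shl_map_succ_append,
    List.length_ofFn, Finset.mul_sum]
  refine Finset.sum_congr rfl fun J hJ => ?_
  obtain ⟨hJU, hJc⟩ := Finset.mem_powersetCard.1 hJ
  have hcard : (U \ J).card = 2 * n - 2 * k := by rw [Finset.card_sdiff_of_subset hJU, hU, hJc]
  simp only [Signature.mult_extend_succ hk]
  rw [shl_replicate_zero t s hcard, evenTerm, splitWeight, ← Finset.prod_sdiff hJU, ← Nat.mul_sub]
  -- The prefactor clears all level-0 denominators: it leaves a - s_0 for the variables above level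
  -- 0 and 1 for those on it.
  have e2 : (∏ a ∈ J, (a - s 0) / (1 - s 0 * a)) * ∏ a ∈ J, (1 - s 0 * a) = ∏ a ∈ J, (a - s 0) := by
    rw [← Finset.prod_mul_distrib]
    exact Finset.prod_congr rfl fun a ha => div_mul_cancel₀ _ (hs a (hJU ha) 0).1
  have e3 : (∏ a ∈ U \ J, (1 - s 0 * a)) * ∏ a ∈ U \ J, (1 - s 0 * a)⁻¹ = 1 := by
    rw [← Finset.prod_mul_distrib]
    exact Finset.prod_eq_one fun a ha =>
      mul_inv_cancel₀ (hs a (Finset.mem_sdiff.1 ha).1 0).1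
  change _ = d (2 * (n - k)) * tPochhammer t t (2 * (n - k)) * _ *
    ((∏ᶠ i, partWeight t (s (i + 1)) (lam.1.mult i)) * _)
  rw [← e2]
  linear_combination (d (2 * (n - k)) * (∏ a ∈ J, (1 - s 0 * a)) *
    (∏ᶠ i, partWeight t (s (i + 1)) (lam.1.mult i)) * (∏ a ∈ J, (a - s 0) / (1 - s 0 * a)) *
    shl t (tailParam s) (List.ofFn lam.1.1) J * (∏ j ∈ J, ∏ i ∈ U \ J, crossWeight t j i) *
    tPochhammer t t (2 * (n - k))) * e3

theorem sum_range_even {g : ℕ → ℂ} (hg : ∀ j, Odd j → g j = 0) (n : ℕ) :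
    ∑ j ∈ Finset.range (2 * n + 1), g j = ∑ k ∈ Finset.range (n + 1), g (2 * k) := by
  induction n with
  | zero => simp
  | succ n ih =>
    rw [Finset.sum_range_succ _ (n + 1), ← ih, show 2 * (n + 1) + 1 = 2 * n + 1 + 1 + 1 by ring,
      Finset.sum_range_succ, Finset.sum_range_succ, hg (2 * n + 1) (by simp), add_zero]
    rfl

theorem levelSum_eq_sum (t s w : ℂ) {n : ℕ} (hU : U.card = 2 * n) :
    levelSum t s w U = ∑ k : Fin (n + 1), ∑ J ∈ U.powersetCard (2 * (k : ℕ)),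
      levelCoeff t s w (n - k) * splitWeight t s U J * littlewoodPf t J := by
  rw [levelSum, Finset.sum_powerset, hU, sum_range_even _ n, Finset.sum_range]
  · refine Finset.sum_congr rfl fun k _ => Finset.sum_congr rfl fun J hJ => ?_
    rw [(Finset.mem_powersetCard.1 hJ).2, show (2 * n - 2 * (k : ℕ)) / 2 = n - k by omega]
  · intro j hj
    refine Finset.sum_eq_zero fun J hJ => ?_
    rw [littlewoodPf, matchSum_odd _ _ (by rwa [(Finset.mem_powersetCard.1 hJ).2]), mul_zero]

theorem one_sub_pow_ne_zero (ht1 : ‖t‖ < 1) {j : ℕ} (hj : j ≠ 0) : 1 - t ^ j ≠ 0 := by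
  intro h
  have h1 : ‖t‖ ^ j = 1 := by rw [← norm_pow, ← sub_eq_zero.1 h, norm_one]
  exact (pow_lt_one₀ (norm_nonneg t) ht1 hj).ne h1

theorem tPochhammer_ne_zero (ht1 : ‖t‖ < 1) (k : ℕ) : tPochhammer t t k ≠ 0 :=
  Finset.prod_ne_zero_iff.2 fun j _ => by
    rw [← pow_succ']; exact one_sub_pow_ne_zero ht1 (Nat.succ_ne_zero j)

/-- For this w each factor splits: (1 - q)(1 - s²tq) + wq = (1 - s²γ⁻¹q)(1 - γtq). -/
theorem levelCoeff_eq_prod (t s : ℂ) {γ : ℂ} (hγ : γ ≠ 0) (k : ℕ) :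
    levelCoeff t s ((1 - s ^ 2 * γ⁻¹) * (1 - γ * t)) k = ∏ j ∈ Finset.Icc 1 k,
      (1 - s ^ 2 * γ⁻¹ * t ^ (2 * j - 2)) * (1 - γ * t ^ (2 * j - 1)) := by
  induction k with
  | zero => simp [levelCoeff]
  | succ k ih =>
    rw [levelCoeff, Finset.prod_range_succ, ← levelCoeff, ih,
      Finset.prod_Icc_succ_top (Nat.succ_le_succ (Nat.zero_le k)),
      show 2 * (k + 1) - 2 = 2 * k by omega, show 2 * (k + 1) - 1 = 2 * k + 1 by omega]
    congr 1
    field_simp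
    ring

/-- This is the case γ = 1, where the level-0 weight agrees with that of every other level. -/
theorem partWeight_mul_tPochhammer (ht1 : ‖t‖ < 1) (s : ℂ) (k : ℕ) :
    partWeight t s (2 * k) * tPochhammer t t (2 * k) =
      levelCoeff t s ((1 - s ^ 2) * (1 - t)) k := by
  induction k with
  | zero => simp [partWeight, tPochhammer, levelCoeff]
  | succ k ih =>
    rw [levelCoeff, Finset.prod_range_succ, ← levelCoeff, ← ih, partWeight, partWeight,
      show 2 * (k + 1) / 2 = k + 1 by omega, show 2 * k / 2 = k by omega,
      Finset.prod_Icc_succ_top (Nat.succ_le_succ (Nat.zero_le k)),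
      show 2 * (k + 1) - 2 = 2 * k by omega, show 2 * (k + 1) = 2 * k + 1 + 1 by ring,
      tPochhammer_succ, tPochhammer_succ]
    have h := one_sub_pow_ne_zero ht1 (j := 2 * k + 1 + 1) (by omega)
    field_simp
    ring

/-- Since (1 - sa)(1 - sb) - (a - s)(b - s) = (1 - s²)(1 - ab), the pair weight becomes (1 - t)(1 -
sa)(1 - sb)/(1 - ab). -/
theorem refinedPf_littlewood (t s : ℂ) (hU : Nonreciprocal U) :
    refinedPf t s ((1 - s ^ 2) * (1 - t)) U = (∏ a ∈ U, (1 - s * a)) * littlewoodPf t U := by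
  refine matchSum_scale _ fun a ha b hb => ?_
  have h : 1 - a * b ≠ 0 := sub_ne_zero.2 (hU a ha b hb).symm
  rw [pairWeight, pairWeight]
  field_simp
  ring

theorem prod_one_sub_mul_evenTerm (t : ℂ) (s : ℕ → ℂ) {N : ℕ} (lam : EvenSignature N)
    (U : Finset ℂ) : (∏ a ∈ U, (1 - s 0 * a)) * evenTerm t s lam U =
      partWeight t (s 0) (lam.1.mult 0) * (∏ a ∈ U, (1 - s 0 * a)) *
        (∏ᶠ i, partWeight t (s (i + 1)) (lam.1.mult (i + 1))) * shl t s (List.ofFn lam.1.1) U := by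
  rw [evenTerm, finprod_partWeight_eq_mul]
  ring

/-- The deviation from the Littlewood identity is transported by one level. -/
theorem prod_mul_littlewoodSum_sub (ht0 : t ≠ 0) (ht1 : ‖t‖ < 1) (hr0 : 0 ≤ r) (hr1 : r < 1)
    (hs : Admissible r U s) {n : ℕ} (hU : U.card = 2 * n)
    (ih : ∀ k < n, ∀ J ⊆ U, J.card = 2 * k → littlewoodSum t (tailParam s) k J = littlewoodPf t J) :
    (∏ a ∈ U, (1 - s 0 * a)) * (littlewoodSum t s n U - littlewoodPf t U) =
      (∏ a ∈ U, (a - s 0)) * (littlewoodSum t (tailParam s) n U - littlewoodPf t U) := by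
  have hnon := hs.nonreciprocal hr0 hr1
  have h1 := hasSum_branching ht1 hr0 hr1 hs hU (partWeight t (s 0))
  have h2 := (summable_evenTerm ht1 hr0 hr1 hs (2 * n)).hasSum.mul_left (∏ a ∈ U, (1 - s 0 * a))
  simp only [prod_one_sub_mul_evenTerm] at h2
  have h3 := h2.unique h1
  have h4 := levelSum_eq_refinedPf ht0 ht1 (s 0) ((1 - s 0 ^ 2) * (1 - t)) hnon hU
  rw [refinedPf_littlewood _ _ hnon, levelSum_eq_sum _ _ _ hU] at h4
  rw [mul_sub, ← h4, littlewoodSum, h3, ← Finset.sum_sub_distrib]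
  simp only [← Finset.sum_sub_distrib]
  -- For smaller J the identity is already known, so only J = U, with no part equal to 0,
  -- contributes.
  rw [Finset.sum_eq_single (Fin.last n)]
  · have hp : U.powersetCard (2 * ((Fin.last n : Fin (n + 1)) : ℕ)) = {U} := by
      rw [Fin.val_last, ← hU, Finset.powersetCard_self]
    rw [hp, Finset.sum_singleton, Fin.val_last, Nat.sub_self, mul_zero, partWeight_zero]
    simp only [tPochhammer, levelCoeff, splitWeight, Finset.range_zero, Finset.prod_empty,
      sdiff_self, Finset.prod_const_one, Finset.bot_eq_empty]
    ring
  · intro k _ hk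
    have hkn : (k : ℕ) < n := by
      have h5 := k.2
      have h6 : (k : ℕ) ≠ n := fun h => hk (Fin.ext h)
      omega
    refine Finset.sum_eq_zero fun J hJ => ?_
    obtain ⟨hJU, hJc⟩ := Finset.mem_powersetCard.1 hJ
    rw [ih k hkn J hJU hJc, partWeight_mul_tPochhammer ht1, sub_self]
  · simp

/-- The Littlewood identity for spin Hall–Littlewood functions. -/
theorem littlewoodSum_eq (ht0 : t ≠ 0) (ht1 : ‖t‖ < 1) (hr0 : 0 ≤ r) (hr1 : r < 1)
    (hs : Admissible r U s) {n : ℕ} (hU : U.card = 2 * n) :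
    littlewoodSum t s n U = littlewoodPf t U := by
  induction n using Nat.strong_induction_on generalizing U s with
  | _ n ih =>
  rcases Nat.eq_zero_or_pos n with rfl | hn
  · rw [mul_zero, Finset.card_eq_zero] at hU
    subst hU
    rw [littlewoodPf_empty, littlewoodSum]
    have : ∀ lam : EvenSignature (2 * 0), evenTerm t s lam ∅ = 1 := by
      intro lam
      have hm : ∀ i, lam.1.mult i = 0 := fun i => Nat.le_zero.1 (lam.1.mult_le i)
      simp [evenTerm, hm, partWeight_zero, shl]
    have huniq : Unique (EvenSignature (2 * 0)) :=
      { default := ⟨⟨fun _ => 0, antitone_const⟩, fun i => by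
          rw [Nat.le_zero.1 (Signature.mult_le _ i)]; exact Even.zero⟩
        uniq := fun lam => Subtype.ext (Subtype.ext (funext fun i => absurd i.2 (by omega))) }
    simp [this, tsum_fintype]
  have hne : U.Nonempty := Finset.card_pos.1 (by omega)
  have step : ∀ s, Admissible r U s → littlewoodSum t s n U - littlewoodPf t U =
      (∏ a ∈ U, (a - s 0) / (1 - s 0 * a)) *
        (littlewoodSum t (tailParam s) n U - littlewoodPf t U) := by
    intro s hs
    have h := prod_mul_littlewoodSum_sub ht0 ht1 hr0 hr1 hs hU fun k hk J hJ hJc =>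
      ih k hk (hs.tail.mono hJ) hJc
    have hp : ∏ a ∈ U, (1 - s 0 * a) ≠ 0 := Finset.prod_ne_zero_iff.2 fun a ha => (hs a ha 0).1
    rw [Finset.prod_div_distrib, div_mul_eq_mul_div, eq_div_iff hp, mul_comm, h]
  obtain ⟨B, hB⟩ := exists_norm_tsum_evenTerm_le ht1 hr0 hr1 U (2 * n)
  -- Each shift of the parameters gains a factor r, while B does not depend on the parameters.
  have bound : ∀ K : ℕ, ∀ s, Admissible r U s →
      ‖littlewoodSum t s n U - littlewoodPf t U‖ ≤ r ^ K * (B + ‖littlewoodPf t U‖) := by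
    intro K
    induction K with
    | zero =>
      intro s hs
      rw [pow_zero, one_mul]
      exact (norm_sub_le _ _).trans (add_le_add (hB s hs) le_rfl)
    | succ K ihK =>
      intro s hs
      rw [step s hs, norm_mul, pow_succ', mul_assoc]
      refine mul_le_mul ?_ (ihK _ hs.tail) (norm_nonneg _) hr0
      rw [norm_prod]
      refine (Finset.prod_le_prod (fun _ _ => norm_nonneg _) fun a ha => (hs a ha 0).2).trans ?_
      rw [Finset.prod_const]
      exact pow_le_of_le_one hr0 hr1.le (Finset.card_pos.2 hne).ne'
  have hlim : Tendsto (fun K : ℕ => r ^ K * (B + ‖littlewoodPf t U‖)) atTop (𝓝 0) := by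
    simpa using (tendsto_pow_atTop_nhds_zero_of_lt_one hr0 hr1).mul_const (B + ‖littlewoodPf t U‖)
  exact sub_eq_zero.1 (norm_le_zero_iff.1 (ge_of_tendsto' hlim fun K => bound K s hs))

/-- The refined Littlewood identity for a set of variables. -/
theorem hasSum_refinedPf (ht0 : t ≠ 0) (ht1 : ‖t‖ < 1) (hr0 : 0 ≤ r) (hr1 : r < 1)
    (hs : Admissible r U s) {n : ℕ} (hU : U.card = 2 * n) {γ : ℂ} (hγ : γ ≠ 0) :
    HasSum (fun lam : EvenSignature (2 * n) => 1 / tPochhammer t t (lam.1.mult 0) *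
        (∏ j ∈ Finset.Icc 1 (lam.1.mult 0 / 2),
          (1 - s 0 ^ 2 * γ⁻¹ * t ^ (2 * j - 2)) * (1 - γ * t ^ (2 * j - 1))) *
        (∏ a ∈ U, (1 - s 0 * a)) *
        (∏ᶠ i, partWeight t (s (i + 1)) (lam.1.mult (i + 1))) * shl t s (List.ofFn lam.1.1) U)
      (refinedPf t (s 0) ((1 - s 0 ^ 2 * γ⁻¹) * (1 - γ * t)) U) := by
  convert hasSum_branching ht1 hr0 hr1 hs hU fun m => 1 / tPochhammer t t m *
    ∏ j ∈ Finset.Icc 1 (m / 2), (1 - s 0 ^ 2 * γ⁻¹ * t ^ (2 * j - 2)) * (1 - γ * t ^ (2 * j - 1))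
    using 1
  rw [← levelSum_eq_refinedPf ht0 ht1 _ _ (hs.nonreciprocal hr0 hr1) hU, levelSum_eq_sum _ _ _ hU]
  refine Finset.sum_congr rfl fun k _ => Finset.sum_congr rfl fun J hJ => ?_
  obtain ⟨hJU, hJc⟩ := Finset.mem_powersetCard.1 hJ
  -- Above level 0 the series is the unrefined one; the Pochhammer symbol from the zeros cancels the
  -- normalisation of their weight.
  rw [littlewoodSum_eq ht0 ht1 hr0 hr1 (hs.tail.mono hJU) hJc, levelCoeff_eq_prod _ _ hγ,
    Nat.mul_div_cancel_left _ two_pos]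
  have := tPochhammer_ne_zero ht1 (t := t) (2 * (n - k))
  field_simp

end

end

theorem theorem1 (n : ℕ) (t : ℝ) (ht0 : 0 < t) (ht1 : t < 1) (γ : ℂ) (hγ : γ ≠ 0)
    (s : ℕ → ℂ) (u : Fin (2 * n) → ℂ)
    (hden : ∀ (i : Fin (2 * n)) (x : ℕ), 1 - s x * u i ≠ 0)
    (ε : ℝ) (hε : 0 < ε)
    (hadm : ∀ (i : Fin (2 * n)) (x : ℕ), ‖(u i - s x) / (1 - s x * u i)‖ ≤ 1 - ε)
    (hu : Function.Injective u)
    (htu : ∀ i j : Fin (2 * n), i ≠ j → 1 - (t : ℂ) * u i * u j ≠ 0) :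
    HasSum
      (fun lam : EvenSignature (2 * n) =>
        1 / tPochhammer (t : ℂ) (t : ℂ) (lam.1.mult 0) *
        (∏ j ∈ Finset.Icc 1 (lam.1.mult 0 / 2),
          (1 - s 0 ^ 2 * γ⁻¹ * (t : ℂ) ^ (2 * j - 2)) * (1 - γ * (t : ℂ) ^ (2 * j - 1))) *
        (∏ j : Fin (2 * n), (1 - s 0 * u j)) *
        (∏ᶠ i : ℕ, ∏ j ∈ Finset.Icc 1 (lam.1.mult (i + 1) / 2),
          (1 - s (i + 1) ^ 2 * (t : ℂ) ^ (2 * j - 2)) / (1 - (t : ℂ) ^ (2 * j))) *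
        spinHallLittlewood (t : ℂ) s lam.1 u)
      ((∏ i : Fin (2 * n), ∏ j ∈ Finset.Ioi i, (1 - (t : ℂ) * u i * u j) / (u i - u j)) *
        pfaffian (Matrix.of fun i j : Fin (2 * n) =>
          (u i - u j) *
            ((1 - (t : ℂ)) * (1 - s 0 * u i) * (1 - s 0 * u j) +
              (1 - γ) * ((t : ℂ) - s 0 ^ 2 * γ⁻¹) * (1 - u i * u j)) /
            ((1 - u i * u j) * (1 - (t : ℂ) * u i * u j)))) := by
  have htn : ‖(t : ℂ)‖ < 1 := by rwa [Complex.norm_of_nonneg ht0.le]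
  have htc : (t : ℂ) ≠ 0 := Complex.ofReal_ne_zero.2 ht0.ne'
  -- The maximum covers ε > 1, which is possible when there are no variables.
  have hr0 : 0 ≤ max (1 - ε) 0 := le_max_right _ _
  have hr1 : max (1 - ε) 0 < 1 := max_lt (by linarith) one_pos
  set U := Finset.univ.image u with hU
  have hcard : U.card = 2 * n := by
    rw [hU, Finset.card_image_of_injective _ hu, Finset.card_univ, Fintype.card_fin]
  have hs : Admissible (max (1 - ε) 0) U s := by
    intro a ha x
    obtain ⟨i, _, rfl⟩ := Finset.mem_image.1 ha
    exact ⟨hden i x, (hadm i x).trans (le_max_left _ _)⟩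
  have hnon := hs.nonreciprocal hr0 hr1
  have h := hasSum_refinedPf htc htn hr0 hr1 hs hcard hγ
  rw [refinedPf, hU, ← prod_mul_pfaffian (pairKernel t) (fun a b => (a - b) *
    ((1 - (t : ℂ)) * (1 - s 0 * a) * (1 - s 0 * b) +
      (1 - γ) * ((t : ℂ) - s 0 ^ 2 * γ⁻¹) * (1 - a * b)) /
        ((1 - a * b) * (1 - (t : ℂ) * a * b))) _ (pairKernel_antisymm t) n hu] at h
  · convert h using 2 with lam
    · rw [spinHallLittlewood_eq_shl _ _ _ hu, Finset.prod_image hu.injOn]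
      rfl
    · rfl
  · intro i j hij
    have h1 : u i - u j ≠ 0 := sub_ne_zero.2 fun e => hij (hu e)
    have h2 := htu i j hij
    have h3 : 1 - u i * u j ≠ 0 := sub_ne_zero.2 (hnon _
      (Finset.mem_image_of_mem u (Finset.mem_univ i)) _
      (Finset.mem_image_of_mem u (Finset.mem_univ j))).symm
    -- The numerators agree because (1 - t)(1 - s_0²) + (1 - γ)(t - s_0²γ⁻¹) = (1 - s_0²γ⁻¹)(1 -
    -- γt).
    rw [pairKernel, pairWeight]
    field_simp
    ring
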